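/- **Setting.** Let $G$ be a discrete group, $A$ a $C^*$-algebra and $\alpha=((A_g)_{g\in G},(\alpha_g)_{g\in G})$ a partial action of $G$ on $A$ (closed two-sided ideals $A_g\subseteq A$ with $A_1=A$ and $*$-isomorphisms $\alpha_g\colon A_{g^{-1}}\to A_g$ with $\alpha_1=\mathrm{id}$ such that $\alpha_{gh}$ extends $\alpha_g\circ\alpha_h$). Let $n\in\mathbb N$, let $\mathcal T_n(G)=\{\tau\subseteq G: 1\in\tau,\ |\tau|=n\}$, and put $A_\tau=\bigcap_{g\in\tau}A_g$ for $\tau\in\mathcal T_n(G)$. Assume that $\alpha$ has the *$n$-decomposition property*: $A=\overline{\sum_{\tau\in\mathcal T_n(G)}A_\tau}$, and $A_\tau\cap A_g=\{0\}$ for all $\tau\in\mathcal T_n(G)$ and $g\in G\setminus\tau$. For $\tau\in\mathcal T_n(G)$ let $G\cdot\tau=\{g\tau: g\in\tau^{-1}\}$ be its orbit under the partial action of $G$ on $\mathcal T_n(G)$ by left translation, let $\mathcal O_n(G)$ be the set of orbits, let $A_{G\cdot\tau}=\sum_{g\in\tau^{-1}}A_{g\tau}$ (an $\alpha$-invariant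 closed ideal of $A$, with the restricted partial action, whose domains are $(A_{G\cdot\tau})_g=A_{G\cdot\tau}\cap A_g$), and let $H=H_\tau=\{h\in G: h\tau=\tau\}$, a finite subgroup of $G$. Choose $x_0=1,x_1,\dots,x_m\in G$ with $\tau=Hx_0\sqcup Hx_1\sqcup\dots\sqcup Hx_m$. Let $\pi_j\colon A_{G\cdot\tau}\to A_{x_j^{-1}\tau}$ be the canonical quotient map ($\pi_j(a)=\lim_\lambda ae_\lambda$ for any approximate identity $(e_\lambda)$ of $A_{x_j^{-1}\tau}$). For a partial action $\beta=((B_g)_{g\in G},(\beta_g)_{g\in G})$ of $G$ on a $C^*$-algebra $B$, let $B\rtimes_\beta G$ be the (full) partial crossed product, densely spanned by the elements $b\delta_g$ with $b\in B_g$, and let $B^G=\{b\in B:\beta_{g^{-1}}(bc)=b\beta_{g^{-1}}(c)\text{ for all }g\in G,\ c\in B_g\}$ be the fixed point algebra. A *corner embedding* into a $C^*$-algebra $D$ is an injective $*$-homomorphism into $D$ whose image is $pDp$ for some projection $p$ in the multiplier algebra $M(D)$. **Theorem.** Let $\tau\in\mathcal T_n(G)$. 1. There is an injective $*$-homomorphism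 $c_\tau\colon A_{G\cdot\tau}^G\to A_{G\cdot\tau}\rtimes_\alpha G$ given by $$c_\tau(a)=\frac{1}{|H|(m+1)}\sum_{j,k=0}^m\sum_{h\in H}\pi_j(a)\,\delta_{x_j^{-1}hx_k},$$ and there is a projection $c_\tau(1)\in M(A_{G\cdot\tau}\rtimes_\alpha G)$ such that $$c_\tau(1)(a\delta_g)=\frac{1}{|H|(m+1)}\sum_{j,k=0}^m\sum_{h\in H}\alpha_{x_j^{-1}hx_k}(\pi_k(a))\,\delta_{x_j^{-1}hx_kg}\qquad (g\in G,\ a\in (A_{G\cdot\tau})_g)$$ and $c_\tau(A_{G\cdot\tau}^G)=c_\tau(1)\,(A_{G\cdot\tau}\rtimes_\alpha G)\,c_\tau(1)$. 2. $c_\tau$ does not depend on the choice of $x_1,\dots,x_m$. 3. $c_{g\tau}=c_\tau$ for all $g\in\tau^{-1}$. Moreover, every $a\in A^G$ can be written uniquely as a norm convergent (unordered) sum $a=\sum_{z\in\mathcal O_n(G)}a_z$ with $a_z\in A_z^G$, where $A_z=A_{G\cdot\tau}$ for $z=G\cdot\tau$. There is a corner embedding $c\colon A^G\to A\rtimes_\alpha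 G$ such that, for every section $z\mapsto\tau_z$ of the orbit map $\mathcal T_n(G)\to\mathcal O_n(G)$ and all choices of the $x_j$, one has $c(a)=\sum_{z}\iota_z(c_{\tau_z}(a_z))$, where $\iota_z\colon A_z\rtimes_\alpha G\to A\rtimes_\alpha G$ is the canonical map $a\delta_g\mapsto a\delta_g$. Its image is the corner $p(A\rtimes_\alpha G)p$ for a projection $p\in M(A\rtimes_\alpha G)$ with $p\,\iota_z(b)=\iota_z(c_{\tau}(1)b)$ for all orbits $z$, all $\tau\in z$ and all $b\in A_z\rtimes_\alpha G$. -/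

import Mathlib

open scoped ENNReal MultiplierAlgebra

universe u v

/-- A closed two-sided ideal of a C⋆-algebra.  (Closed two-sided ideals of C⋆-algebras are
automatically self-adjoint, so asking for a `⋆`-subalgebra is no restriction.) -/
structure ClosedIdeal (A : Type u) [NonUnitalCStarAlgebra A] where
  alg : NonUnitalStarSubalgebra ℂ A
  isClosed_alg : IsClosed (alg : Set A)
  mul_mem_left : ∀ (x : A) {a : A}, a ∈ alg → x * a ∈ alg
  mul_mem_right : ∀ (x : A) {a : A}, a ∈ alg → a * x ∈ alg

noncomputable instance ClosedIdeal.instCStar {A : Type u} [NonUnitalCStarAlgebra A]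
    (I : ClosedIdeal A) : NonUnitalCStarAlgebra I.alg :=
  NonUnitalStarSubalgebra.nonUnitalCStarAlgebra I.alg (h_closed := I.isClosed_alg)

/-- A partial action of the discrete group `G` on the C⋆-algebra `A`: closed ideals `A_g` and
`⋆`-homomorphisms `α_g : A_{g⁻¹} → A_g` with `A_1 = A`, `α_1 = id`, such that `α_{gh}` extends
`α_g ∘ α_h` (on the largest domain on which the composition makes sense).  The maps are
automatically `⋆`-isomorphisms, see `PartialAction.act_bijective`. -/
structure PartialAction (G : Type v) [Group G] (A : Type u) [NonUnitalCStarAlgebra A] where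
  dom : G → ClosedIdeal A
  act : ∀ g : G, (dom g⁻¹).alg →⋆ₙₐ[ℂ] (dom g).alg
  dom_one : (dom 1).alg = ⊤
  act_one : ∀ a : (dom 1⁻¹).alg, (act 1 a : A) = a
  act_mul : ∀ (g h : G) (a : (dom h⁻¹).alg) (ha : (act h a : A) ∈ (dom g⁻¹).alg),
    ∃ ha' : (a : A) ∈ (dom (g * h)⁻¹).alg,
      (act (g * h) ⟨a, ha'⟩ : A) = act g ⟨act h a, ha⟩

namespace PartialAction

variable {G : Type v} [Group G] {A : Type u} [NonUnitalCStarAlgebra A] (α : PartialAction G A)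

theorem act_congr {g g' : G} (hg : g = g') (a : (α.dom g⁻¹).alg) (a' : (α.dom g'⁻¹).alg)
    (ha : (a : A) = a') : (α.act g a : A) = α.act g' a' := by
  subst hg
  rw [Subtype.ext ha]

theorem mem_congr {g g' : G} (hg : g = g') {a : A} (ha : a ∈ (α.dom g).alg) :
    a ∈ (α.dom g').alg := hg ▸ ha

/-- The inverse `α_g⁻¹ = α_{g⁻¹} : A_g → A_{g⁻¹}`. -/
noncomputable def inv (g : G) (a : (α.dom g).alg) : (α.dom g⁻¹).alg :=
  α.act g⁻¹ ⟨a, α.mem_congr (inv_inv g).symm a.2⟩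

theorem inv_act (g : G) (a : (α.dom g⁻¹).alg) : (α.inv g (α.act g a) : A) = a := by
  have hmem : (α.act g a : A) ∈ (α.dom g⁻¹⁻¹).alg :=
    α.mem_congr (inv_inv g).symm (α.act g a).2
  obtain ⟨h1, h2⟩ := α.act_mul g⁻¹ g a hmem
  have h3 : (a : A) ∈ (α.dom 1⁻¹).alg := α.mem_congr (by simp) h1
  unfold inv
  rw [← h2, α.act_congr (inv_mul_cancel g) _ ⟨a, h3⟩ rfl, α.act_one]

theorem act_inv (g : G) (a : (α.dom g).alg) : (α.act g (α.inv g a) : A) = a := by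
  have hmem : (α.inv g a : A) ∈ (α.dom g⁻¹).alg := (α.inv g a).2
  obtain ⟨h1, h2⟩ := α.act_mul g g⁻¹ ⟨a, α.mem_congr (inv_inv g).symm a.2⟩ hmem
  have h3 : (a : A) ∈ (α.dom 1⁻¹).alg := α.mem_congr (by simp) h1
  have h4 : (α.act g (α.inv g a) : A) = α.act g ⟨α.inv g a, hmem⟩ := rfl
  rw [h4]
  unfold inv
  rw [← h2, α.act_congr (mul_inv_cancel g) _ ⟨a, h3⟩ rfl, α.act_one]

theorem act_bijective (g : G) : Function.Bijective (α.act g) :=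
  ⟨fun a b hab => Subtype.ext (by rw [← α.inv_act g a, ← α.inv_act g b, hab]),
    fun a => ⟨α.inv g a, Subtype.ext (α.act_inv g a)⟩⟩

/-- `α_g(A_{g⁻¹} ∩ A_h) ⊆ A_{gh}`. -/
theorem act_mem (g h : G) (a : (α.dom g⁻¹).alg) (ha : (a : A) ∈ (α.dom h).alg) :
    (α.act g a : A) ∈ (α.dom (g * h)).alg := by
  have e := α.act_inv h ⟨a, ha⟩
  have hm : (α.act h (α.inv h ⟨a, ha⟩) : A) ∈ (α.dom g⁻¹).alg := by rw [e]; exact a.2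
  obtain ⟨h1, h2⟩ := α.act_mul g h (α.inv h ⟨a, ha⟩) hm
  have : (α.act g a : A) = α.act g ⟨α.act h (α.inv h ⟨a, ha⟩), hm⟩ :=
    α.act_congr rfl _ _ e.symm
  rw [this, ← h2]
  exact (α.act (g * h) _).2

/-! ### The crossed product -/

/-- The product in the crossed product: `(a δ_g)(b δ_h) = α_g(α_g⁻¹(a) b) δ_{gh}`. -/
noncomputable def deltaMul (g h : G) (a : (α.dom g).alg) (b : (α.dom h).alg) :
    (α.dom (g * h)).alg :=
  ⟨α.act g ⟨α.inv g a * b, (α.dom g⁻¹).mul_mem_right _ (α.inv g a).2⟩,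
    α.act_mem g h _ ((α.dom h).mul_mem_left _ b.2)⟩

/-- The involution in the crossed product: `(a δ_g)⋆ = α_g⁻¹(a⋆) δ_{g⁻¹}`. -/
noncomputable def deltaStar (g : G) (a : (α.dom g).alg) : (α.dom g⁻¹).alg :=
  α.inv g (star a)

/-- A `⋆`-representation, in some C⋆-algebra `B`, of the `⋆`-algebra of finite formal sums
`∑ a_g δ_g`, `a_g ∈ A_g`, given by its restrictions `a ↦ φ_g(a) = φ(a δ_g)` to the summands. -/
structure Rep (α : PartialAction G A) : Type (max u v + 1) where
  B : Type (max u v)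
  [inst : NonUnitalCStarAlgebra B]
  φ : ∀ g : G, (α.dom g).alg →ₗ[ℂ] B
  φ_mul : ∀ (g h : G) (a : (α.dom g).alg) (b : (α.dom h).alg),
    φ g a * φ h b = φ (g * h) (α.deltaMul g h a b)
  φ_star : ∀ (g : G) (a : (α.dom g).alg), star (φ g a) = φ g⁻¹ (α.deltaStar g a)

attribute [instance] Rep.inst

variable {α}

theorem Rep.φ_congr (ρ : Rep α) {g g' : G} (hg : g = g') (a : (α.dom g).alg) (a' : (α.dom g').alg)
    (ha : (a : A) = a') : ρ.φ g a = ρ.φ g' a' := by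
  subst hg
  rw [Subtype.ext ha]

theorem Rep.norm_one_le (ρ : Rep α) (a : (α.dom 1).alg) : ‖ρ.φ 1 a‖ ≤ ‖a‖ := by
  have hinv : ∀ a : (α.dom 1).alg, (α.inv 1 a : A) = a := fun a => by
    unfold inv
    rw [α.act_congr inv_one _ ⟨a, α.mem_congr (by simp) a.2⟩ rfl, α.act_one]
  let f : (α.dom 1).alg →⋆ₙₐ[ℂ] ρ.B :=
    { toFun := ρ.φ 1
      map_smul' := fun c x => (ρ.φ 1).map_smul c x
      map_zero' := (ρ.φ 1).map_zero
      map_add' := fun x y => (ρ.φ 1).map_add x y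
      map_mul' := fun x y => by
        rw [ρ.φ_mul]
        refine ρ.φ_congr (mul_one 1).symm _ _ ?_
        have hm : (x * y : A) ∈ (α.dom 1⁻¹).alg := α.mem_congr (by simp) (x * y).2
        change (x * y : A) = α.act 1 _
        rw [α.act_congr rfl _ ⟨x * y, hm⟩ (by simp [hinv]), α.act_one]
      map_star' := fun x => by
        rw [ρ.φ_star]
        refine ρ.φ_congr inv_one.symm _ _ ?_
        change (star x : (α.dom 1).alg).1 = α.inv 1 (star x)
        rw [hinv] }
  exact NonUnitalStarAlgHom.norm_apply_le f a

theorem Rep.norm_le (ρ : Rep α) (g : G) (a : (α.dom g).alg) : ‖ρ.φ g a‖ ≤ ‖a‖ := by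
  have h1 : (a * star a : A) ∈ (α.dom 1).alg := by rw [α.dom_one]; trivial
  have key : ρ.φ g a * star (ρ.φ g a) = ρ.φ 1 ⟨a * star a, h1⟩ := by
    rw [ρ.φ_star, ρ.φ_mul]
    refine ρ.φ_congr (mul_inv_cancel g) _ _ ?_
    change (α.act g _ : A) = _
    have e : (α.act g (α.inv g a * α.inv g (star a)) : A) = a * (star a : (α.dom g).alg) := by
      rw [_root_.map_mul]
      change (α.act g _ : A) * (α.act g _ : A) = _
      rw [α.act_inv, α.act_inv]
    exact e
  have h2 : ‖ρ.φ g a‖ * ‖ρ.φ g a‖ ≤ ‖a‖ * ‖a‖ := by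
    rw [← CStarRing.norm_self_mul_star, key]
    refine (ρ.norm_one_le _).trans ?_
    exact (CStarRing.norm_self_mul_star (x := (a : A))).le
  exact abs_le_of_sq_le_sq' (by nlinarith) (norm_nonneg _) |>.2

variable (α)

/-- The element `a δ_g` in the universal representation, that is, in the bounded product of all
representations. -/
noncomputable def deltaAux (g : G) : (α.dom g).alg →ₗ[ℂ] lp (fun ρ : Rep α => ρ.B) ∞ where
  toFun a := ⟨fun ρ => ρ.φ g a, memℓp_infty ⟨‖a‖, by rintro _ ⟨ρ, rfl⟩; exact ρ.norm_le g a⟩⟩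
  map_add' a b := by ext ρ; exact map_add _ _ _
  map_smul' c a := by ext ρ; exact map_smul _ _ _

/-- The closed `⋆`-algebra generated by the elements `a δ_g` in the universal representation. -/
noncomputable def crossedAlg : NonUnitalStarSubalgebra ℂ (lp (fun ρ : Rep α => ρ.B) ∞) :=
  (NonUnitalStarAlgebra.adjoin ℂ {y | ∃ (g : G) (a : (α.dom g).alg), y = α.deltaAux g a}
    ).topologicalClosure

/-- The (full) partial crossed product `A ⋊_α G`: the completion of the `⋆`-algebra of finite
sums `∑ a_g δ_g` in the largest C⋆-seminorm, realised in its universal representation. -/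
def CrossedProduct : Type (max u v + 1) := α.crossedAlg

noncomputable instance : NonUnitalCStarAlgebra α.CrossedProduct :=
  NonUnitalStarSubalgebra.nonUnitalCStarAlgebra α.crossedAlg
    (h_closed := NonUnitalStarSubalgebra.isClosed_topologicalClosure _)

theorem deltaAux_mem (g : G) (a : (α.dom g).alg) : α.deltaAux g a ∈ α.crossedAlg :=
  NonUnitalStarSubalgebra.le_topologicalClosure _
    (NonUnitalStarAlgebra.subset_adjoin ℂ _ ⟨g, a, rfl⟩)

/-- The element `a δ_g` of the crossed product. -/
noncomputable def delta (g : G) : (α.dom g).alg →ₗ[ℂ] α.CrossedProduct where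
  toFun a := ⟨α.deltaAux g a, α.deltaAux_mem g a⟩
  map_add' _ _ := Subtype.ext (map_add _ _ _)
  map_smul' _ _ := Subtype.ext (map_smul _ _ _)

theorem delta_mul (g h : G) (a : (α.dom g).alg) (b : (α.dom h).alg) :
    α.delta g a * α.delta h b = α.delta (g * h) (α.deltaMul g h a b) :=
  Subtype.ext (lp.ext (funext fun ρ => ρ.φ_mul g h a b))

theorem star_delta (g : G) (a : (α.dom g).alg) :
    star (α.delta g a) = α.delta g⁻¹ (α.deltaStar g a) :=
  Subtype.ext (lp.ext (funext fun ρ => ρ.φ_star g a))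

/-- The universal property: each representation extends to the crossed product. -/
noncomputable def lift (ρ : Rep α) : α.CrossedProduct →⋆ₙₐ[ℂ] ρ.B where
  toFun x := x.1 ρ
  map_smul' _ _ := rfl
  map_zero' := rfl
  map_add' _ _ := rfl
  map_mul' _ _ := rfl
  map_star' _ := rfl

theorem lift_delta (ρ : Rep α) (g : G) (a : (α.dom g).alg) :
    α.lift ρ (α.delta g a) = ρ.φ g a := rfl

/-! ### Restriction to invariant ideals -/

/-- The ideal `I` is invariant: `α_g(I ∩ A_{g⁻¹}) ⊆ I` for all `g`. -/
def IsInvariant (I : ClosedIdeal A) : Prop :=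
  ∀ (g : G) (a : (α.dom g⁻¹).alg), (a : A) ∈ I.alg → (α.act g a : A) ∈ I.alg


end PartialAction

namespace PartialAction

variable {G : Type v} [Group G] {A : Type u} [NonUnitalCStarAlgebra A] {α : PartialAction G A}

/-- The ideal `I ∩ A_g` of `I`. -/
noncomputable def restrictDom (α : PartialAction G A) (I : ClosedIdeal A) (g : G) :
    ClosedIdeal I.alg where
  alg := (α.dom g).alg.comap (NonUnitalStarSubalgebraClass.subtype I.alg)
  isClosed_alg := (α.dom g).isClosed_alg.preimage continuous_subtype_val
  mul_mem_left x _ ha := (α.dom g).mul_mem_left (x : A) ha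
  mul_mem_right x _ ha := (α.dom g).mul_mem_right (x : A) ha

/-- The inclusion `I ∩ A_g → A_g`. -/
noncomputable def restrictIncl (α : PartialAction G A) (I : ClosedIdeal A) (g : G) :
    (α.restrictDom I g).alg →⋆ₙₐ[ℂ] (α.dom g).alg where
  toFun a := ⟨a.1.1, a.2⟩
  map_smul' _ _ := rfl
  map_zero' := rfl
  map_add' _ _ := rfl
  map_mul' _ _ := rfl
  map_star' _ := rfl

/-- The restriction `I ∩ A_{g⁻¹} → I ∩ A_g` of `α_g`. -/
noncomputable def restrictAct (I : ClosedIdeal A) (hI : α.IsInvariant I) (g : G) :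
    (α.restrictDom I g⁻¹).alg →⋆ₙₐ[ℂ] (α.restrictDom I g).alg where
  toFun a := ⟨⟨α.act g (α.restrictIncl I g⁻¹ a), hI g _ a.1.2⟩,
    (α.act g (α.restrictIncl I g⁻¹ a)).2⟩
  map_smul' c a := by
    refine Subtype.ext (Subtype.ext ?_)
    change (α.act g (α.restrictIncl I g⁻¹ (c • a)) : A) = c • (α.act g _ : A)
    rw [map_smul, map_smul]; rfl
  map_zero' := by
    refine Subtype.ext (Subtype.ext ?_)
    change (α.act g (α.restrictIncl I g⁻¹ 0) : A) = 0
    rw [map_zero, map_zero]; rfl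
  map_add' a b := by
    refine Subtype.ext (Subtype.ext ?_)
    change (α.act g (α.restrictIncl I g⁻¹ (a + b)) : A) = (α.act g _ : A) + (α.act g _ : A)
    rw [map_add, map_add]; rfl
  map_mul' a b := by
    refine Subtype.ext (Subtype.ext ?_)
    change (α.act g (α.restrictIncl I g⁻¹ (a * b)) : A) = (α.act g _ : A) * (α.act g _ : A)
    rw [map_mul, map_mul]; rfl
  map_star' a := by
    refine Subtype.ext (Subtype.ext ?_)
    change (α.act g (α.restrictIncl I g⁻¹ (star a)) : A) = star (α.act g _ : A)
    rw [map_star, map_star]; rfl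

/-- The restriction of a partial action to an invariant ideal `I`, with domains `I ∩ A_g`. -/
noncomputable def restrict (I : ClosedIdeal A) (hI : α.IsInvariant I) : PartialAction G I.alg where
  dom := α.restrictDom I
  act := restrictAct I hI
  dom_one := by
    ext x
    change (x : A) ∈ (α.dom 1).alg ↔ _
    rw [α.dom_one]
    exact ⟨fun _ => trivial, fun _ => trivial⟩
  act_one a := Subtype.ext (α.act_one (α.restrictIncl I 1⁻¹ a))
  act_mul g h a ha := by
    obtain ⟨h1, h2⟩ := α.act_mul g h (α.restrictIncl I h⁻¹ a) ha
    exact ⟨h1, Subtype.ext h2⟩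

/-- A representation of the system restricted to `I`, obtained by restricting one of `A`. -/
noncomputable def Rep.restrict (ρ : Rep α) (I : ClosedIdeal A) (hI : α.IsInvariant I) :
    Rep (PartialAction.restrict I hI) where
  B := ρ.B
  φ g := (ρ.φ g).comp (LinearMapClass.linearMap (α.restrictIncl I g))
  φ_mul g h a b := ρ.φ_mul g h (α.restrictIncl I g a) (α.restrictIncl I h b)
  φ_star g a := ρ.φ_star g (α.restrictIncl I g a)

noncomputable def inclAux (I : ClosedIdeal A) (hI : α.IsInvariant I) :
    lp (fun ρ : Rep (restrict I hI) => ρ.B) ∞ →⋆ₙₐ[ℂ] lp (fun ρ : Rep α => ρ.B) ∞ where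
  toFun x := ⟨fun ρ => x (ρ.restrict I hI), memℓp_infty ⟨‖x‖, by
    rintro _ ⟨ρ, rfl⟩; exact lp.norm_apply_le_norm (by simp) x (ρ.restrict I hI)⟩⟩
  map_smul' _ _ := rfl
  map_zero' := rfl
  map_add' _ _ := rfl
  map_mul' _ _ := rfl
  map_star' _ := rfl

theorem inclAux_mem (I : ClosedIdeal A) (hI : α.IsInvariant I)
    (x : lp (fun ρ : Rep (restrict I hI) => ρ.B) ∞) (hx : x ∈ (restrict I hI).crossedAlg) :
    inclAux I hI x ∈ α.crossedAlg := by
  have hle : (restrict I hI).crossedAlg ≤ α.crossedAlg.comap (inclAux I hI) := by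
    refine NonUnitalStarSubalgebra.topologicalClosure_minimal _ ?_ ?_
    · refine NonUnitalStarAlgebra.adjoin_le ?_
      rintro _ ⟨g, a, rfl⟩
      exact α.deltaAux_mem g (α.restrictIncl I g a)
    · have hc : Continuous (inclAux I hI) := 
        AddMonoidHomClass.continuous_of_bound (inclAux I hI) 1 fun x => by
          rw [one_mul]
          exact lp.norm_le_of_forall_le (norm_nonneg x) fun ρ =>
            lp.norm_apply_le_norm (by simp) x (ρ.restrict I hI)
      exact (NonUnitalStarSubalgebra.isClosed_topologicalClosure _).preimage hc
  exact hle hx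

/-- The canonical `⋆`-homomorphism `I ⋊_α G → A ⋊_α G`, `a δ_g ↦ a δ_g`, for an invariant ideal
`I` of `A`. -/
noncomputable def incl (I : ClosedIdeal A) (hI : α.IsInvariant I) :
    (restrict I hI).CrossedProduct →⋆ₙₐ[ℂ] α.CrossedProduct where
  toFun x := ⟨inclAux I hI x.1, inclAux_mem I hI x.1 x.2⟩
  map_smul' _ _ := rfl
  map_zero' := rfl
  map_add' _ _ := rfl
  map_mul' _ _ := rfl
  map_star' _ := rfl

theorem incl_delta (I : ClosedIdeal A) (hI : α.IsInvariant I) (g : G)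
    (a : ((restrict I hI).dom g).alg) :
    incl I hI ((restrict I hI).delta g a) = α.delta g (α.restrictIncl I g a) := rfl

end PartialAction

/-! ### Tuples -/

section Tuples

variable {G : Type v} [Group G] {n : ℕ}

/-- The set `𝒯_n(G)` of subsets `τ ⊆ G` with `1 ∈ τ` and `|τ| = n`. -/
def Tuple (G : Type v) [Group G] (n : ℕ) : Type v := {τ : Finset G // 1 ∈ τ ∧ τ.card = n}

instance : Membership G (Tuple G n) := ⟨fun τ g => g ∈ τ.1⟩

namespace Tuple

theorem ext {τ σ : Tuple G n} (h : ∀ g, g ∈ τ ↔ g ∈ σ) : τ = σ :=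
  Subtype.ext (Finset.ext h)

theorem one_mem (τ : Tuple G n) : (1 : G) ∈ τ := τ.2.1

/-- The partial action of `G` on `𝒯_n(G)` by left translation: `τ ↦ gτ`, if `g⁻¹ ∈ τ`. -/
def translate (τ : Tuple G n) (g : G) (hg : g⁻¹ ∈ τ) : Tuple G n :=
  ⟨τ.1.map (Equiv.mulLeft g).toEmbedding,
    Finset.mem_map.2 ⟨g⁻¹, hg, mul_inv_cancel g⟩, by rw [Finset.card_map]; exact τ.2.2⟩

theorem mem_translate (τ : Tuple G n) (g : G) (hg : g⁻¹ ∈ τ) (k : G) :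
    k ∈ τ.translate g hg ↔ g⁻¹ * k ∈ τ := by
  change k ∈ τ.1.map _ ↔ g⁻¹ * k ∈ τ.1
  rw [Finset.mem_map_equiv]
  rfl

/-- The orbit equivalence relation on `𝒯_n(G)`. -/
instance orbitSetoid (G : Type v) [Group G] (n : ℕ) : Setoid (Tuple G n) where
  r τ σ := ∃ (g : G) (hg : g⁻¹ ∈ τ), τ.translate g hg = σ
  iseqv :=
    { refl := fun τ => ⟨1, by simpa using τ.one_mem, ext fun k => by simp [mem_translate]⟩
      symm := by
        rintro τ _ ⟨g, hg, rfl⟩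
        refine ⟨g⁻¹, ?_, ext fun k => ?_⟩
        · rw [mem_translate]; simpa using τ.one_mem
        · simp [mem_translate]
      trans := by
        rintro τ _ _ ⟨g, hg, rfl⟩ ⟨k, hk, rfl⟩
        refine ⟨k * g, ?_, ext fun l => ?_⟩
        · simpa [mem_translate] using hk
        · simp [mem_translate, mul_assoc] }

end Tuple

/-- The orbit space `𝒪_n(G)`. -/
def TupleOrbit (G : Type v) [Group G] (n : ℕ) : Type v := Quotient (Tuple.orbitSetoid G n)

namespace Tuple

/-- The orbit `G · τ` of `τ`. -/
def orbit (τ : Tuple G n) : TupleOrbit G n := Quotient.mk _ τ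

theorem orbit_translate (τ : Tuple G n) (g : G) (hg : g⁻¹ ∈ τ) :
    (τ.translate g hg).orbit = τ.orbit :=
  (Quotient.sound (s := orbitSetoid G n) ⟨g, hg, rfl⟩ : τ.orbit = (τ.translate g hg).orbit).symm

theorem orbit_eq_iff (τ σ : Tuple G n) :
    τ.orbit = σ.orbit ↔ ∃ (g : G) (hg : g⁻¹ ∈ τ), τ.translate g hg = σ :=
  Quotient.eq (r := orbitSetoid G n)

/-- The subgroup `H_τ = {h : hτ = τ}`; equivalently, `h k ∈ τ ↔ k ∈ τ` for all `k ∈ G`. -/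
def stab (τ : Tuple G n) : Subgroup G where
  carrier := {h | ∀ k, h * k ∈ τ ↔ k ∈ τ}
  one_mem' k := by rw [one_mul]
  mul_mem' {a b} ha hb k := by rw [mul_assoc, ha, hb]
  inv_mem' {a} ha k := by rw [← ha, mul_inv_cancel_left]

theorem mem_of_mem_stab {τ : Tuple G n} {h : G} (hh : h ∈ τ.stab) : h ∈ τ := by
  have := (hh 1).2 τ.one_mem
  rwa [mul_one] at this

noncomputable instance (τ : Tuple G n) : Fintype τ.stab :=
  Fintype.ofInjective (fun h : τ.stab => (⟨h, mem_of_mem_stab h.2⟩ : τ.1))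
    fun _ _ hab => Subtype.ext (congrArg (fun x : τ.1 => (x : G)) hab)

end Tuple

/-- A choice of elements `x_0 = 1, x_1, …, x_m` with `τ = H_τ x_0 ⊔ H_τ x_1 ⊔ … ⊔ H_τ x_m`. -/
structure Transversal (τ : Tuple G n) where
  m : ℕ
  x : Fin (m + 1) → G
  x_zero : x 0 = 1
  mem_iff : ∀ g : G, g ∈ τ ↔ ∃ j, ∃ h ∈ τ.stab, g = h * x j
  disjoint : ∀ i j, ∀ h ∈ τ.stab, ∀ k ∈ τ.stab, h * x i = k * x j → i = j

/-- Such choices exist. -/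
theorem Transversal.exists (τ : Tuple G n) : Nonempty (Transversal τ) := by
  classical
  let S : Setoid τ.1 :=
    { r := fun a b => (a : G) * (b : G)⁻¹ ∈ τ.stab
      iseqv :=
        { refl := fun a => by simp
          symm := fun {a b} h => by simpa using τ.stab.inv_mem h
          trans := fun {a b c} h k => by simpa using τ.stab.mul_mem h k } }
  have : Fintype (Quotient S) := Fintype.ofFinite _
  let q : Quotient S := Quotient.mk S ⟨1, τ.one_mem⟩
  have : Nonempty (Quotient S) := ⟨q⟩
  obtain ⟨m, hm⟩ := Nat.exists_eq_succ_of_ne_zero (Fintype.card_ne_zero (α := Quotient S))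
  let e0 : Quotient S ≃ Fin (m + 1) := Fintype.equivFinOfCardEq hm
  let e : Quotient S ≃ Fin (m + 1) := e0.trans (Equiv.swap (e0 q) 0)
  have heq : e q = 0 := by simp [e]
  let r : Quotient S → τ.1 := fun c => if c = q then ⟨1, τ.one_mem⟩ else c.out
  have hr : ∀ c, Quotient.mk S (r c) = c := fun c => by
    by_cases hc : c = q
    · simp only [r, if_pos hc]; exact hc.symm
    · simp only [r, if_neg hc]; exact c.out_eq
  have hstab : ∀ h ∈ τ.stab, ∀ a b : τ.1, (a : G) = h * b → Quotient.mk S a = Quotient.mk S b :=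
    fun h hh a b hab => Quotient.sound (by
      change (a : G) * (b : G)⁻¹ ∈ τ.stab
      rw [hab]; simpa using hh)
  refine ⟨⟨m, fun j => r (e.symm j), ?_, fun g => ⟨fun hg => ?_, ?_⟩, ?_⟩⟩
  · have : e.symm 0 = q := by rw [← heq, e.symm_apply_apply]
    simp [this, r]
  · refine ⟨e (Quotient.mk S ⟨g, hg⟩), g * (r (Quotient.mk S ⟨g, hg⟩) : G)⁻¹, ?_, ?_⟩
    · exact Quotient.exact (s := S) (hr (Quotient.mk S ⟨g, hg⟩)).symm
    · simp
  · rintro ⟨j, h, hh, rfl⟩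
    exact (hh _).2 (r (e.symm j)).2
  · intro i j h hh k hk hij
    have h1 : (r (e.symm i) : G) = (h⁻¹ * k) * r (e.symm j) := by
      rw [mul_assoc, ← hij, inv_mul_cancel_left]
    have h2 := hstab _ (τ.stab.mul_mem (τ.stab.inv_mem hh) hk) _ _ h1
    rw [hr, hr] at h2
    exact e.symm.injective h2

end Tuples

namespace PartialAction

variable {G : Type v} [Group G] {A : Type u} [NonUnitalCStarAlgebra A] (α : PartialAction G A)

/-! ### Fixed points -/

/-- `a` is `G`-invariant: `α_{g⁻¹}(a b) = a α_{g⁻¹}(b)` for all `g ∈ G` and `b ∈ A_g`. -/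
def IsFixed (a : A) : Prop :=
  ∀ (g : G) (b : (α.dom g).alg),
    (α.inv g ⟨a * b, (α.dom g).mul_mem_left a b.2⟩ : A) = a * α.inv g b

theorem inv_congr {g : G} (a b : (α.dom g).alg) (h : (a : A) = b) :
    (α.inv g a : A) = α.inv g b := by rw [Subtype.ext h]

theorem inv_mul' {g : G} (a b : (α.dom g).alg) :
    (α.inv g (a * b) : A) = α.inv g a * α.inv g b := by
  unfold inv
  exact congrArg Subtype.val (map_mul (α.act g⁻¹) ⟨a, _⟩ ⟨b, _⟩)

theorem inv_add {g : G} (a b : (α.dom g).alg) :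
    (α.inv g (a + b) : A) = α.inv g a + α.inv g b := by
  unfold inv
  exact congrArg Subtype.val (map_add (α.act g⁻¹) ⟨a, _⟩ ⟨b, _⟩)

theorem inv_smul {g : G} (c : ℂ) (a : (α.dom g).alg) :
    (α.inv g (c • a) : A) = c • (α.inv g a : A) := by
  unfold inv
  exact congrArg Subtype.val (map_smul (α.act g⁻¹) c ⟨a, _⟩)

theorem inv_star {g : G} (a : (α.dom g).alg) :
    (α.inv g (star a) : A) = star (α.inv g a : A) := by
  unfold inv
  exact congrArg Subtype.val (map_star (α.act g⁻¹) ⟨a, _⟩)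

variable {α}

theorem IsFixed.right {a : A} (ha : α.IsFixed a) (g : G) (b : (α.dom g).alg) :
    (α.inv g ⟨b * a, (α.dom g).mul_mem_right a b.2⟩ : A) = α.inv g b * a := by
  set w : (α.dom g).alg := ⟨b * a, (α.dom g).mul_mem_right a b.2⟩ with hw
  have hmem : (α.inv g b : A) * a ∈ (α.dom g⁻¹).alg :=
    (α.dom g⁻¹).mul_mem_right a (α.inv g b).2
  let y : (α.dom g⁻¹).alg := α.inv g w - ⟨_, hmem⟩
  have key : ∀ e : (α.dom g).alg, (y : A) * α.inv g e = 0 := fun e => by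
    change ((α.inv g w : A) - α.inv g b * a) * α.inv g e = 0
    rw [sub_mul, ← inv_mul', mul_assoc, ← ha g e, ← inv_mul', sub_eq_zero]
    exact α.inv_congr _ _ (mul_assoc _ _ _)
  have h1 := key (α.act g (star y))
  rw [inv_act] at h1
  have h2 : (y : A) = 0 := (CStarRing.mul_star_self_eq_zero_iff (y : A)).1 h1
  exact sub_eq_zero.1 h2

variable (α)

/-- The fixed point algebra `A^G`. -/
def fixedPoints : NonUnitalStarSubalgebra ℂ A where
  carrier := {a | α.IsFixed a}
  zero_mem' g b := by
    have e : (⟨0 * b, (α.dom g).mul_mem_left 0 b.2⟩ : (α.dom g).alg) = (0 : ℂ) • b :=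
      Subtype.ext (by simp)
    rw [e, inv_smul, zero_smul, zero_mul]
  add_mem' {x y} hx hy g b := by
    have e : (⟨(x + y) * b, (α.dom g).mul_mem_left (x + y) b.2⟩ : (α.dom g).alg)
        = ⟨x * b, (α.dom g).mul_mem_left x b.2⟩ + ⟨y * b, (α.dom g).mul_mem_left y b.2⟩ :=
      Subtype.ext (add_mul _ _ _)
    rw [e, inv_add, hx, hy, add_mul]
  mul_mem' {x y} hx hy g b := by
    have := hx g ⟨y * b, (α.dom g).mul_mem_left y b.2⟩
    rw [hy] at this
    rw [mul_assoc x y (α.inv g b : A), ← this]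
    exact α.inv_congr _ _ (mul_assoc _ _ _)
  smul_mem' c x hx g b := by
    have e : (⟨(c • x) * b, (α.dom g).mul_mem_left (c • x) b.2⟩ : (α.dom g).alg)
        = c • ⟨x * b, (α.dom g).mul_mem_left x b.2⟩ :=
      Subtype.ext (smul_mul_assoc _ _ _)
    rw [e, inv_smul, hx, smul_mul_assoc]
  star_mem' {x} hx g b := by
    have h1 := IsFixed.right hx g (star b)
    have e : (⟨star x * b, (α.dom g).mul_mem_left (star x) b.2⟩ : (α.dom g).alg)
        = star ⟨(star b : (α.dom g).alg) * x, (α.dom g).mul_mem_right x (star b).2⟩ :=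
      Subtype.ext (by
        change star x * (b : A) = star (star (b : A) * x)
        rw [star_mul, star_star])
    rw [e, inv_star, h1, star_mul, inv_star, star_star]

/-! ### The decomposition property -/

/-- The ideal `A_τ = ⋂_{g ∈ τ} A_g`. -/
def tupleIdeal {n : ℕ} (τ : Tuple G n) : ClosedIdeal A where
  alg := ⨅ g : τ.1, (α.dom g).alg
  isClosed_alg := by
    rw [NonUnitalStarAlgebra.coe_iInf]
    exact isClosed_iInter fun g => (α.dom g).isClosed_alg
  mul_mem_left x a ha := by
    rw [NonUnitalStarAlgebra.mem_iInf] at ha ⊢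
    exact fun g => (α.dom g).mul_mem_left x (ha g)
  mul_mem_right x a ha := by
    rw [NonUnitalStarAlgebra.mem_iInf] at ha ⊢
    exact fun g => (α.dom g).mul_mem_right x (ha g)

theorem mem_tupleIdeal {n : ℕ} (τ : Tuple G n) (a : A) :
    a ∈ (α.tupleIdeal τ).alg ↔ ∀ g ∈ τ, a ∈ (α.dom g).alg := by
  change a ∈ (⨅ g : τ.1, (α.dom g).alg) ↔ _
  rw [NonUnitalStarAlgebra.mem_iInf]
  exact ⟨fun h g hg => h ⟨g, hg⟩, fun h g => h g g.2⟩

/-- The linear subspace underlying a closed ideal. -/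
def _root_.ClosedIdeal.toSubmodule (I : ClosedIdeal A) : Submodule ℂ A :=
  I.alg.toNonUnitalSubalgebra.toSubmodule

/-- The `n`-decomposition property. -/
structure HasDecomposition (n : ℕ) : Prop where
  dense : (⨆ τ : Tuple G n, (α.tupleIdeal τ).toSubmodule).topologicalClosure = ⊤
  inter : ∀ (τ : Tuple G n) (g : G), g ∉ τ →
    (α.tupleIdeal τ).toSubmodule ⊓ (α.dom g).toSubmodule = ⊥

end PartialAction

namespace PartialAction

variable {G : Type v} [Group G] {A : Type u} [NonUnitalCStarAlgebra A] {α : PartialAction G A}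
  {n : ℕ}

section Component

theorem tuple_unique (I : ClosedIdeal A) {b b' : A} (hb : b ∈ I.alg) (hb' : b' ∈ I.alg)
    (h : ∀ c ∈ I.alg, b * c = b' * c) : b = b' := by
  have h1 := h _ (star_mem (sub_mem hb hb'))
  rw [← sub_eq_zero, ← sub_mul] at h1
  exact sub_eq_zero.1 ((CStarRing.mul_star_self_eq_zero_iff _).1 h1)

namespace HasDecomposition

theorem eq_zero (h : α.HasDecomposition n) {τ : Tuple G n} {g : G} (hg : g ∉ τ) {a : A} (ha : a ∈ (α.tupleIdeal τ).alg)
    (ha' : a ∈ (α.dom g).alg) : a = 0 := by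
  have : a ∈ (α.tupleIdeal τ).toSubmodule ⊓ (α.dom g).toSubmodule := ⟨ha, ha'⟩
  rw [h.inter τ g hg] at this
  exact this

theorem eq_zero_of_ne (h : α.HasDecomposition n) {τ σ : Tuple G n} (hne : τ ≠ σ) {a : A} (ha : a ∈ (α.tupleIdeal τ).alg)
    (ha' : a ∈ (α.tupleIdeal σ).alg) : a = 0 := by
  have : ∃ g ∈ σ, g ∉ τ := by
    by_contra! hcon
    exact hne (Subtype.ext (Finset.eq_of_subset_of_card_le hcon
      (by rw [τ.2.2, σ.2.2])).symm)
  obtain ⟨g, hg, hg'⟩ := this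
  exact h.eq_zero hg' ha ((α.mem_tupleIdeal σ a).1 ha' g hg)

/-- Each `a ∈ A` has a unique component in `A_τ`. -/
theorem exists_component (h : α.HasDecomposition n) (τ : Tuple G n) (a : A) :
    ∃ b ∈ (α.tupleIdeal τ).alg, ∀ c ∈ (α.tupleIdeal τ).alg, a * c = b * c := by
  let I := α.tupleIdeal τ
  let S : Submodule ℂ A :=
    { carrier := {a | ∃ b ∈ I.alg, ∀ c ∈ I.alg, a * c = b * c}
      zero_mem' := ⟨0, zero_mem _, fun _ _ => rfl⟩
      add_mem' := by
        rintro x y ⟨b, hb, hb'⟩ ⟨d, hd, hd'⟩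
        exact ⟨b + d, add_mem hb hd, fun c hc => by rw [add_mul, add_mul, hb' c hc, hd' c hc]⟩
      smul_mem' := by
        rintro r x ⟨b, hb, hb'⟩
        exact ⟨r • b, SMulMemClass.smul_mem r hb,
          fun c hc => by rw [smul_mul_assoc, smul_mul_assoc, hb' c hc]⟩ }
  have hS : IsClosed (S : Set A) := by
    refine IsSeqClosed.isClosed ?_
    intro u x hu hx
    choose b hb hb' using hu
    have hle : ∀ i j, ‖b i - b j‖ ≤ ‖u i - u j‖ := fun i j => by
      have h1 := sub_mem (hb i) (hb j)
      have h2 : (u i - u j) * star (b i - b j) = (b i - b j) * star (b i - b j) := by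
        rw [sub_mul, sub_mul, hb' i _ (star_mem h1), hb' j _ (star_mem h1)]
      have h3 := norm_mul_le (u i - u j) (star (b i - b j))
      rw [h2, CStarRing.norm_self_mul_star, norm_star] at h3
      by_contra! hlt
      have := mul_lt_mul_of_pos_right hlt ((norm_nonneg _).trans_lt hlt)
      linarith
    have hc : CauchySeq b := by
      have hu : CauchySeq u := hx.cauchySeq
      rw [Metric.cauchySeq_iff] at hu ⊢
      intro ε hε
      obtain ⟨N, hN⟩ := hu ε hε
      refine ⟨N, fun i hi j hj => lt_of_le_of_lt ?_ (hN i hi j hj)⟩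
      rw [dist_eq_norm, dist_eq_norm]
      exact hle i j
    obtain ⟨y, hy⟩ := cauchySeq_tendsto_of_complete hc
    refine ⟨y, I.isClosed_alg.mem_of_tendsto hy (Filter.Eventually.of_forall hb), fun c hcI => ?_⟩
    refine tendsto_nhds_unique (hx.mul_const c) ?_
    simp_rw [fun i => hb' i c hcI]
    exact hy.mul_const c
  have hle : (⨆ σ : Tuple G n, (α.tupleIdeal σ).toSubmodule) ≤ S := by
    refine iSup_le fun σ a ha => ?_
    by_cases hσ : σ = τ
    · subst hσ; exact ⟨a, ha, fun _ _ => rfl⟩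
    · refine ⟨0, zero_mem _, fun c hc => ?_⟩
      rw [zero_mul]
      exact h.eq_zero_of_ne hσ ((α.tupleIdeal σ).mul_mem_right c ha)
        ((α.tupleIdeal τ).mul_mem_left a hc)
  have := Submodule.topologicalClosure_minimal _ hle hS
  rw [h.dense] at this
  exact this trivial

variable (h : α.HasDecomposition n)

/-- The component `π_τ(a) ∈ A_τ` of `a ∈ A`: the unique element of `A_τ` with `a c = π_τ(a) c` for
all `c ∈ A_τ`; equivalently, the limit of `a e_λ` for any approximate identity of `A_τ`. -/
noncomputable def component (τ : Tuple G n) (a : A) : A :=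
  (h.exists_component τ a).choose

theorem component_mem (τ : Tuple G n) (a : A) : h.component τ a ∈ (α.tupleIdeal τ).alg :=
  (h.exists_component τ a).choose_spec.1

theorem component_mul (τ : Tuple G n) (a c : A) (hc : c ∈ (α.tupleIdeal τ).alg) :
    a * c = h.component τ a * c :=
  (h.exists_component τ a).choose_spec.2 c hc

theorem component_eq (τ : Tuple G n) {a b : A} (hb : b ∈ (α.tupleIdeal τ).alg)
    (hab : ∀ c ∈ (α.tupleIdeal τ).alg, a * c = b * c) : h.component τ a = b :=
  tuple_unique _ (h.component_mem τ a) hb fun c hc => by rw [← h.component_mul τ a c hc, hab c hc]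

theorem component_self (τ : Tuple G n) {a : A} (ha : a ∈ (α.tupleIdeal τ).alg) :
    h.component τ a = a := h.component_eq τ ha fun _ _ => rfl

theorem component_of_ne {τ σ : Tuple G n} (hne : τ ≠ σ) {a : A}
    (ha : a ∈ (α.tupleIdeal τ).alg) : h.component σ a = 0 :=
  h.component_eq σ (zero_mem _) fun c hc => by
    rw [zero_mul]
    exact h.eq_zero_of_ne hne ((α.tupleIdeal τ).mul_mem_right c ha)
        ((α.tupleIdeal σ).mul_mem_left a hc)

/-- The component of an element of `A_g` lies in `A_g`. -/
theorem component_mem_dom (τ : Tuple G n) {a : A} {g : G} (ha : a ∈ (α.dom g).alg) :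
    h.component τ a ∈ (α.dom g).alg := by
  by_cases hg : g ∈ τ
  · exact (α.mem_tupleIdeal τ _).1 (h.component_mem τ a) g hg
  · have h1 := h.component_mul τ a _ (star_mem (h.component_mem τ a))
    have h2 : h.component τ a * star (h.component τ a) = 0 :=
      h.eq_zero hg ((α.tupleIdeal τ).mul_mem_right _ (h.component_mem τ a))
        (by rw [← h1]; exact (α.dom g).mul_mem_right _ ha)
    rw [(CStarRing.mul_star_self_eq_zero_iff _).1 h2]
    exact zero_mem _

theorem component_add (τ : Tuple G n) (a b : A) :
    h.component τ (a + b) = h.component τ a + h.component τ b :=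
  h.component_eq τ (add_mem (h.component_mem τ a) (h.component_mem τ b)) fun c hc => by
    rw [add_mul, add_mul, h.component_mul τ a c hc, h.component_mul τ b c hc]

theorem component_smul (τ : Tuple G n) (r : ℂ) (a : A) :
    h.component τ (r • a) = r • h.component τ a :=
  h.component_eq τ (SMulMemClass.smul_mem r (h.component_mem τ a)) fun c hc => by
    rw [smul_mul_assoc, smul_mul_assoc, h.component_mul τ a c hc]

theorem norm_component_le (τ : Tuple G n) (a : A) : ‖h.component τ a‖ ≤ ‖a‖ := by
  have h2 := h.component_mul τ a _ (star_mem (h.component_mem τ a))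
  have h3 := norm_mul_le a (star (h.component τ a))
  rw [h2, CStarRing.norm_self_mul_star, norm_star] at h3
  by_contra! hlt
  have := mul_lt_mul_of_pos_right hlt ((norm_nonneg _).trans_lt hlt)
  linarith

/-- `π_τ` as a continuous linear map. -/
noncomputable def componentL (τ : Tuple G n) : A →L[ℂ] A :=
  LinearMap.mkContinuous
    { toFun := h.component τ
      map_add' := h.component_add τ
      map_smul' := h.component_smul τ } 1 fun a => by
    rw [one_mul]; exact h.norm_component_le τ a

end HasDecomposition

end Component

/-! ### The orbit systems -/

variable (α) in
/-- The sum `∑_{σ ∈ z} A_σ` of the ideals belonging to the tuples in the orbit `z`.  For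
`z = G · τ` the tuples `σ` in `z` are the translates `gτ` with `g ∈ τ⁻¹`. -/
def orbitSum (z : TupleOrbit G n) : Submodule ℂ A :=
  ⨆ σ : {σ : Tuple G n // σ.orbit = z}, (α.tupleIdeal σ.1).toSubmodule

theorem finite_orbit (z : TupleOrbit G n) : Finite {σ : Tuple G n // σ.orbit = z} := by
  induction z using Quotient.inductionOn with
  | _ τ =>
    let f : {g : τ.1 // True} → {σ : Tuple G n // σ.orbit = τ.orbit} := fun g =>
      ⟨τ.translate (g.1 : G)⁻¹ (by rw [inv_inv]; exact g.1.2), τ.orbit_translate _ _⟩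
    refine Finite.of_surjective f fun σ => ?_
    obtain ⟨g, hg, hσ⟩ := (τ.orbit_eq_iff σ.1).1 σ.2.symm
    refine ⟨⟨⟨g⁻¹, hg⟩, trivial⟩, Subtype.ext ?_⟩
    rw [← hσ]
    exact Tuple.ext fun k => by simp [f, Tuple.mem_translate]

theorem mem_orbitSum {z : TupleOrbit G n} {σ : Tuple G n} (hσ : σ.orbit = z) {a : A}
    (ha : a ∈ (α.tupleIdeal σ).alg) : a ∈ α.orbitSum z :=
  Submodule.mem_iSup_of_mem (p := fun σ : {σ : Tuple G n // σ.orbit = z} =>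
    (α.tupleIdeal σ.1).toSubmodule) ⟨σ, hσ⟩ ha

theorem orbitSum_induction {z : TupleOrbit G n} {p : A → Prop}
    (mem : ∀ σ : Tuple G n, σ.orbit = z → ∀ a ∈ (α.tupleIdeal σ).alg, p a) (zero : p 0)
    (add : ∀ a b, p a → p b → p (a + b)) {a : A} (ha : a ∈ α.orbitSum z) : p a :=
  Submodule.iSup_induction _ (motive := p) ha (fun σ a ha => mem σ.1 σ.2 a ha) zero add

noncomputable instance (z : TupleOrbit G n) : Fintype {σ : Tuple G n // σ.orbit = z} :=
  have := finite_orbit z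
  Fintype.ofFinite _

namespace HasDecomposition

variable (h : α.HasDecomposition n)

theorem eq_sum_component {z : TupleOrbit G n} {a : A} (ha : a ∈ α.orbitSum z) :
    a = ∑ σ : {σ : Tuple G n // σ.orbit = z}, h.component σ.1 a := by
  classical
  refine orbitSum_induction (α := α) (p := fun a => a = ∑ σ : {σ : Tuple G n // σ.orbit = z},
    h.component σ.1 a) ?_ ?_ ?_ ha
  · intro σ hσ a ha
    rw [Finset.sum_eq_single ⟨σ, hσ⟩, h.component_self σ ha]
    · intro σ' _ hne
      exact h.component_of_ne (fun e => hne (Subtype.ext e.symm)) ha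
    · simp
  · exact (Finset.sum_eq_zero fun σ _ => h.component_self _ (zero_mem _)).symm
  · intro a b ha hb
    simp_rw [h.component_add]
    rw [Finset.sum_add_distrib, ← ha, ← hb]

/-- The closed ideal `A_{G·τ} = ∑_{g ∈ τ⁻¹} A_{gτ}`, for `z = G · τ`. -/
noncomputable def orbitIdeal (z : TupleOrbit G n) : ClosedIdeal A where
  alg :=
    { α.orbitSum z with
      mul_mem' := fun {a b} _ hb => orbitSum_induction (α := α) (p := fun b => a * b ∈ α.orbitSum z)
        (fun σ hσ b hb => mem_orbitSum hσ ((α.tupleIdeal σ).mul_mem_left a hb))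
        (by rw [mul_zero]; exact zero_mem _)
        (fun b c hb hc => by rw [mul_add]; exact add_mem hb hc) hb
      star_mem' := fun {a} ha => orbitSum_induction (α := α) (p := fun a => star a ∈ α.orbitSum z)
        (fun σ hσ b hb => mem_orbitSum hσ (star_mem hb))
        (by rw [star_zero]; exact zero_mem _)
        (fun b c hb hc => by rw [star_add]; exact add_mem hb hc) ha }
  isClosed_alg := by
    have e : (α.orbitSum z : Set A) =
        {a | a = ∑ σ : {σ : Tuple G n // σ.orbit = z}, h.componentL σ.1 a} := by
      ext a
      refine ⟨fun ha => h.eq_sum_component ha, fun ha => ?_⟩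
      change a = _ at ha
      change a ∈ α.orbitSum z
      rw [ha]
      exact sum_mem fun σ _ => mem_orbitSum σ.2 (h.component_mem σ.1 a)
    change IsClosed (α.orbitSum z : Set A)
    rw [e]
    exact isClosed_eq continuous_id
      (continuous_finsetSum _ fun σ _ => (h.componentL σ.1).continuous)
  mul_mem_left x a ha := orbitSum_induction (α := α) (p := fun b => x * b ∈ α.orbitSum z)
        (fun σ hσ b hb => mem_orbitSum hσ ((α.tupleIdeal σ).mul_mem_left x hb))
        (by rw [mul_zero]; exact zero_mem _)
        (fun b c hb hc => by rw [mul_add]; exact add_mem hb hc) ha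
  mul_mem_right x a ha := orbitSum_induction (α := α) (p := fun b => b * x ∈ α.orbitSum z)
        (fun σ hσ b hb => mem_orbitSum hσ ((α.tupleIdeal σ).mul_mem_right x hb))
        (by rw [zero_mul]; exact zero_mem _)
        (fun b c hb hc => by rw [add_mul]; exact add_mem hb hc) ha

theorem act_tupleIdeal_mem (σ : Tuple G n) (g : G) (hg : g⁻¹ ∈ σ) (a : (α.dom g⁻¹).alg)
    (ha : (a : A) ∈ (α.tupleIdeal σ).alg) :
    (α.act g a : A) ∈ (α.tupleIdeal (σ.translate g hg)).alg := by
  rw [mem_tupleIdeal] at ha ⊢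
  intro k hk
  rw [Tuple.mem_translate] at hk
  have := α.act_mem g _ a (ha _ hk)
  exact α.mem_congr (by simp) this

theorem isInvariant_orbitIdeal (z : TupleOrbit G n) : α.IsInvariant (h.orbitIdeal z) := by
  intro g a ha
  have ha' : (a : A) ∈ α.orbitSum z := ha
  have hmem : ∀ σ : Tuple G n, h.component σ (a : A) ∈ (α.dom g⁻¹).alg :=
    fun σ => h.component_mem_dom σ a.2
  have e : a = ∑ σ : {σ : Tuple G n // σ.orbit = z}, ⟨h.component σ.1 a, hmem σ.1⟩ :=
    Subtype.ext (by
      rw [AddSubmonoidClass.coe_finsetSum]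
      exact h.eq_sum_component ha')
  change (α.act g a : A) ∈ α.orbitSum z
  rw [e, map_sum, AddSubmonoidClass.coe_finsetSum]
  refine sum_mem fun σ _ => ?_
  by_cases hg : g⁻¹ ∈ σ.1
  · exact mem_orbitSum ((σ.1.orbit_translate g hg).trans σ.2)
      (act_tupleIdeal_mem σ.1 g hg _ (h.component_mem σ.1 a))
  · have h0 : (⟨h.component σ.1 a, hmem σ.1⟩ : (α.dom g⁻¹).alg) = 0 :=
      Subtype.ext (h.eq_zero hg (h.component_mem σ.1 a) (hmem σ.1))
    rw [h0, map_zero]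
    exact zero_mem _

/-- The restriction of `α` to the invariant ideal `A_{G·τ}`, for `z = G · τ`. -/
noncomputable def orbitSystem (z : TupleOrbit G n) : PartialAction G (h.orbitIdeal z).alg :=
  restrict (h.orbitIdeal z) (h.isInvariant_orbitIdeal z)

/-- The canonical map `A_{G·τ} ⋊_α G → A ⋊_α G`, for `z = G · τ`. -/
noncomputable def orbitIncl (z : TupleOrbit G n) :
    (h.orbitSystem z).CrossedProduct →⋆ₙₐ[ℂ] α.CrossedProduct :=
  incl (h.orbitIdeal z) (h.isInvariant_orbitIdeal z)

end HasDecomposition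

end PartialAction

namespace PartialAction

variable {G : Type v} [Group G] {A : Type u} [NonUnitalCStarAlgebra A] {α : PartialAction G A}
  {n : ℕ}

/-! ### The corner map -/

theorem _root_.Transversal.x_mem {τ : Tuple G n} (x : Transversal τ) {s : G} (hs : s ∈ τ.stab)
    (j : Fin (x.m + 1)) : s * x.x j ∈ τ :=
  (x.mem_iff _).2 ⟨j, s, hs, rfl⟩

/-- The tuple `x_j⁻¹ τ`. -/
def _root_.Transversal.shift {τ : Tuple G n} (x : Transversal τ) (j : Fin (x.m + 1)) : Tuple G n :=
  τ.translate (x.x j)⁻¹ (by rw [inv_inv, ← one_mul (x.x j)]; exact x.x_mem τ.stab.one_mem j)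

theorem _root_.Transversal.mem_shift {τ : Tuple G n} (x : Transversal τ) (j k : Fin (x.m + 1))
    (s : τ.stab) : (x.x j)⁻¹ * s * x.x k ∈ x.shift j := by
  unfold Transversal.shift
  rw [Tuple.mem_translate, inv_inv, mul_assoc, mul_inv_cancel_left]
  exact x.x_mem s.2 k

namespace HasDecomposition

variable (h : α.HasDecomposition n) {z : TupleOrbit G n} {τ : Tuple G n} (hτ : τ.orbit = z)
  (x : Transversal τ)

/-- The quotient map `π_j : A_{G·τ} → A_{x_j⁻¹τ}`, with values regarded as elements of
`A_{G·τ}`. -/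
noncomputable def proj (j : Fin (x.m + 1)) (a : (h.orbitIdeal z).alg) : (h.orbitIdeal z).alg :=
  ⟨h.component (x.shift j) a,
    mem_orbitSum ((τ.orbit_translate _ _).trans hτ) (h.component_mem (x.shift j) a)⟩

theorem proj_mem (j k : Fin (x.m + 1)) (s : τ.stab) (a : (h.orbitIdeal z).alg) :
    h.proj hτ x j a ∈ ((h.orbitSystem z).dom ((x.x j)⁻¹ * s * x.x k)).alg :=
  (α.mem_tupleIdeal _ _).1 (h.component_mem (x.shift j) a) _ (x.mem_shift j k s)

/-- The element `1/(|H|(m+1)) ∑_{j,k=0}^m ∑_{s ∈ H} π_j(a) δ_{x_j⁻¹ s x_k}` of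
`A_{G·τ} ⋊_α G`. -/
noncomputable def cornerFun (a : (h.orbitIdeal z).alg) : (h.orbitSystem z).CrossedProduct :=
  ((Fintype.card τ.stab : ℂ) * (x.m + 1))⁻¹ •
    ∑ j : Fin (x.m + 1), ∑ k : Fin (x.m + 1), ∑ s : τ.stab,
      (h.orbitSystem z).delta ((x.x j)⁻¹ * s * x.x k)
        ⟨h.proj hτ x j a, h.proj_mem hτ x j k s a⟩

/-- `α_{x_j⁻¹ s x_k}(π_k(a))`, as an element of `A_{G·τ}`. -/
noncomputable def actProj (j k : Fin (x.m + 1)) (s : τ.stab) (a : (h.orbitIdeal z).alg) :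
    ((h.orbitSystem z).dom ((x.x j)⁻¹ * s * x.x k)).alg :=
  (h.orbitSystem z).act ((x.x j)⁻¹ * s * x.x k) ⟨h.proj hτ x k a,
    (h.orbitSystem z).mem_congr (by simp [mul_assoc]) (h.proj_mem hτ x k j s⁻¹ a)⟩

theorem actProj_mem (j k : Fin (x.m + 1)) (s : τ.stab) (g : G)
    (a : ((h.orbitSystem z).dom g).alg) :
    (h.actProj hτ x j k s a : (h.orbitIdeal z).alg) ∈
      ((h.orbitSystem z).dom ((x.x j)⁻¹ * s * x.x k * g)).alg :=
  (h.orbitSystem z).act_mem _ g _ (h.component_mem_dom (x.shift k) a.2)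

/-- The element `1/(|H|(m+1)) ∑_{j,k=0}^m ∑_{s ∈ H} α_{x_j⁻¹ s x_k}(π_k(a)) δ_{x_j⁻¹ s x_k g}` of
`A_{G·τ} ⋊_α G`, for `a ∈ (A_{G·τ})_g`. -/
noncomputable def cornerUnitFun (g : G) (a : ((h.orbitSystem z).dom g).alg) :
    (h.orbitSystem z).CrossedProduct :=
  ((Fintype.card τ.stab : ℂ) * (x.m + 1))⁻¹ •
    ∑ j : Fin (x.m + 1), ∑ k : Fin (x.m + 1), ∑ s : τ.stab,
      (h.orbitSystem z).delta ((x.x j)⁻¹ * s * x.x k * g)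
        ⟨h.actProj hτ x j k s a, h.actProj_mem hτ x j k s g a⟩

end HasDecomposition

end PartialAction

/-- The subset `S` of the C⋆-algebra `B` is the corner `p B p` cut down by the projection `p` of
the multiplier algebra of `B`. -/
def IsCornerBy {B : Type*} [NonUnitalCStarAlgebra B] (p : 𝓜(ℂ, B)) (S : Set B) : Prop :=
  IsStarProjection p ∧
    ∀ b : B, b ∈ S ↔ ∃ y : B, (b : 𝓜(ℂ, B)) = p * (y : 𝓜(ℂ, B)) * p

/-! The guiding object is the transformation groupoid of the partial translation action on tuples.
Its arrows are the pairs `(σ, g)` with `g ∈ σ`, of range `σ` and source `g⁻¹σ`. Every tuple is the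
range of exactly `n` arrows. Elements `a δ_g` with `a ∈ A_σ` and `g ∈ σ` span a dense subspace of
the crossed product, and they multiply like arrows: composable ones give an element of the same
kind, the others give `0` because ideals of distinct tuples are orthogonal.

In these terms `|H|(m+1) = n`, and the double sum over the transversal runs once over each arrow of
the orbit. Hence `c_τ(a) = 1/n ∑ π_σ(a) δ_g` over all arrows `(σ, g)` of the orbit, an expression
that mentions neither the `x_j` nor `τ`; parts 2 and 3 then cost nothing. The same expression summed
over all orbits is the global map `c`. Each orbit ideal again has the `n`-decomposition property, so
every result is proved once for `c` and specialised to `c_τ`.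

An element `a` is fixed exactly when arrows carry its components to one another. Therefore `(a δ_g)
c(b)` with `a ∈ A_σ` equals `1/n ∑_{k ∈ σ} ab δ_k` for every `g ∈ σ` (`single_mul_orbitCorner`);
adding the `n` equal terms makes `c` multiplicative, and inversion of arrows makes it self-adjoint.
For injectivity, a representation by `τ × τ` matrices over `A` separates the terms of `∑_{k ∈ τ} x
δ_k` (`regularRep_single_one`).

For the corner property, averaging over arrows yields many fixed points, enough for an approximate
unit `(e_λ)` of `A^G` to be one of `A` as well (`exists_approximateUnit_fixedPoints`). Then `c(e_λ)`
converges strictly to a projection `p`, and `p (b δ_k) p = c(E(b))`, where `E` is the average over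
the orbit (`orbitCorner_orbitAverage`). So `p D p` is the image of `c`, where `D` is the crossed
product (`exists_isCornerBy`). -/

namespace Tuple

/-! ### Arrows of the transformation groupoid -/

variable {G : Type v} [Group G] {n : ℕ}

open Classical in
/-- The translate `g⁻¹ σ`, for `g ∈ σ`. -/
noncomputable def src (σ : Tuple G n) (g : G) : Tuple G n :=
  if hg : g ∈ σ then σ.translate g⁻¹ (by rwa [inv_inv]) else σ

theorem src_eq {σ : Tuple G n} {g : G} (hg : g ∈ σ) :
    σ.src g = σ.translate g⁻¹ (by rwa [inv_inv]) := dif_pos hg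

theorem mem_src {σ : Tuple G n} {g : G} (hg : g ∈ σ) (k : G) : k ∈ σ.src g ↔ g * k ∈ σ := by
  rw [src_eq hg, mem_translate, inv_inv]

theorem orbit_src (σ : Tuple G n) (g : G) : (σ.src g).orbit = σ.orbit := by
  unfold src
  split_ifs
  · exact σ.orbit_translate _ _
  · rfl

theorem inv_mem_src {σ : Tuple G n} {g : G} (hg : g ∈ σ) : g⁻¹ ∈ σ.src g := by
  rw [mem_src hg, mul_inv_cancel]; exact σ.one_mem

/-- Composition of arrows: `(σ, g)` followed by an arrow `k` with range `g⁻¹σ` is the arrow `(σ,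
gk)`. -/
theorem src_src {σ : Tuple G n} {g k : G} (hg : g ∈ σ) (hk : k ∈ σ.src g) :
    (σ.src g).src k = σ.src (g * k) :=
  ext fun l => by
    rw [mem_src hk, mem_src hg, mem_src ((mem_src hg k).1 hk), mul_assoc]

theorem src_one (σ : Tuple G n) : σ.src 1 = σ :=
  ext fun l => by rw [mem_src σ.one_mem, one_mul]

theorem src_src_inv {σ : Tuple G n} {g : G} (hg : g ∈ σ) : (σ.src g).src g⁻¹ = σ := by
  rw [src_src hg (inv_mem_src hg), mul_inv_cancel, src_one]

theorem orbit_eq_iff_src (τ σ : Tuple G n) : τ.orbit = σ.orbit ↔ ∃ g ∈ τ, τ.src g = σ := by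
  rw [orbit_eq_iff]
  constructor
  · rintro ⟨g, hg, h⟩
    refine ⟨g⁻¹, hg, ?_⟩
    rw [src_eq hg, ← h]
    exact ext fun k => by simp [mem_translate]
  · rintro ⟨g, hg, h⟩
    exact ⟨g⁻¹, by rwa [inv_inv], by rw [← h, src_eq hg]⟩

theorem sum_src {M : Type*} [AddCommMonoid M] {σ : Tuple G n} {k : G} (hk : k ∈ σ) (f : G → M) :
    ∑ g ∈ (σ.src k).1, f g = ∑ g ∈ σ.1, f (k⁻¹ * g) := by
  rw [src_eq hk]
  exact Finset.sum_map _ _ _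

theorem card_pos_of (τ : Tuple G n) : 0 < n := by
  have := Finset.card_pos.2 ⟨1, τ.2.1⟩
  rwa [τ.2.2] at this

theorem natCast_ne_zero (τ : Tuple G n) : (n : ℂ) ≠ 0 :=
  Nat.cast_ne_zero.2 τ.card_pos_of.ne'

end Tuple

namespace TupleOrbit

variable {G : Type v} [Group G] {n : ℕ}

/-- The finite set of the tuples in an orbit. -/
noncomputable def members (z : TupleOrbit G n) : Finset (Tuple G n) :=
  (Set.finite_coe_iff.1 (PartialAction.finite_orbit z) :
    {σ : Tuple G n | σ.orbit = z}.Finite).toFinset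

theorem mem_members {z : TupleOrbit G n} {σ : Tuple G n} : σ ∈ z.members ↔ σ.orbit = z := by
  simp [members]

theorem src_mem_members {z : TupleOrbit G n} {σ : Tuple G n} (hσ : σ ∈ z.members) (g : G) :
    σ.src g ∈ z.members := by
  rw [mem_members] at hσ ⊢
  rw [Tuple.orbit_src, hσ]

/-- Inversion of the arrows of the transformation groupoid of an orbit. -/
theorem sum_swap {M : Type*} [AddCommMonoid M] (z : TupleOrbit G n) (f : Tuple G n → G → M) :
    ∑ σ ∈ z.members, ∑ g ∈ σ.1, f (σ.src g) g⁻¹ = ∑ σ ∈ z.members, ∑ g ∈ σ.1, f σ g := by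
  rw [Finset.sum_sigma', Finset.sum_sigma']
  have key : ∀ p ∈ z.members.sigma (fun σ => σ.1),
      (⟨p.1.src p.2, p.2⁻¹⟩ : Σ _ : Tuple G n, G) ∈ z.members.sigma (fun σ => σ.1) := by
    rintro ⟨σ, g⟩ hp
    rw [Finset.mem_sigma] at hp ⊢
    exact ⟨src_mem_members hp.1 g, Tuple.inv_mem_src hp.2⟩
  have inv : ∀ p ∈ z.members.sigma (fun σ => σ.1),
      (⟨(p.1.src p.2).src p.2⁻¹, p.2⁻¹⁻¹⟩ : Σ _ : Tuple G n, G) = p := by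
    rintro ⟨σ, g⟩ hp
    rw [Finset.mem_sigma] at hp
    simp only [inv_inv, Tuple.src_src_inv (show g ∈ σ from hp.2)]
  exact Finset.sum_nbij' (fun p => ⟨p.1.src p.2, p.2⁻¹⟩) (fun p => ⟨p.1.src p.2, p.2⁻¹⟩)
    key key inv inv fun _ _ => rfl

end TupleOrbit

namespace PartialAction

variable {G : Type v} [Group G] {A : Type u} [NonUnitalCStarAlgebra A] (α : PartialAction G A)
  {n : ℕ}

/-! ### Total versions of the partially defined maps -/

open Classical in
/-- The map `α_{g⁻¹} : A_g → A_{g⁻¹}`, extended by zero. -/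
noncomputable def pull (g : G) (a : A) : A :=
  if ha : a ∈ (α.dom g).alg then α.inv g ⟨a, ha⟩ else 0

theorem pull_of_mem {g : G} {a : A} (ha : a ∈ (α.dom g).alg) : α.pull g a = α.inv g ⟨a, ha⟩ :=
  dif_pos ha

theorem pull_mem (g : G) (a : A) : α.pull g a ∈ (α.dom g⁻¹).alg := by
  unfold pull
  split_ifs with h
  · exact (α.inv g ⟨a, h⟩).2
  · exact zero_mem _

theorem pull_inv_mem (g : G) (a : A) : α.pull g⁻¹ a ∈ (α.dom g).alg :=
  α.mem_congr (inv_inv g) (α.pull_mem g⁻¹ a)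

/-- The index enters through an equation so that group identities such as `(k⁻¹)⁻¹ = k` need no
transport between dependent domains. -/
theorem act_eq_pull {g k : G} (hg : g = k⁻¹) (a : (α.dom g⁻¹).alg) :
    (α.act g a : A) = α.pull k a := by
  subst hg
  have ha : (a : A) ∈ (α.dom k).alg := α.mem_congr (inv_inv k) a.2
  rw [pull_of_mem α ha]
  exact α.act_congr rfl _ _ rfl

theorem pull_zero (g : G) : α.pull g 0 = 0 := by
  rw [pull_of_mem α (zero_mem _)]
  unfold inv
  exact congrArg Subtype.val (map_zero (α.act g⁻¹))

theorem pull_add {g : G} {a b : A} (ha : a ∈ (α.dom g).alg) (hb : b ∈ (α.dom g).alg) :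
    α.pull g (a + b) = α.pull g a + α.pull g b := by
  rw [pull_of_mem α ha, pull_of_mem α hb, pull_of_mem α (add_mem ha hb), ← α.inv_add]
  rfl

theorem pull_smul {g : G} (c : ℂ) {a : A} (ha : a ∈ (α.dom g).alg) :
    α.pull g (c • a) = c • α.pull g a := by
  rw [pull_of_mem α ha, pull_of_mem α (SMulMemClass.smul_mem c ha), ← α.inv_smul]
  rfl

theorem pull_sub {g : G} {a b : A} (ha : a ∈ (α.dom g).alg) (hb : b ∈ (α.dom g).alg) :
    α.pull g (a - b) = α.pull g a - α.pull g b := by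
  have h := α.pull_add (sub_mem ha hb) hb
  rw [sub_add_cancel] at h
  rw [h, add_sub_cancel_right]

theorem pull_sum {ι : Type*} (s : Finset ι) (f : ι → A) {g : G}
    (hf : ∀ i ∈ s, f i ∈ (α.dom g).alg) : α.pull g (∑ i ∈ s, f i) = ∑ i ∈ s, α.pull g (f i) := by
  classical
  induction s using Finset.induction_on with
  | empty => simp [pull_zero]
  | insert i s hi ih =>
    rw [Finset.sum_insert hi, Finset.sum_insert hi, pull_add, ih]
    · exact fun j hj => hf j (Finset.mem_insert_of_mem hj)
    · exact hf i (Finset.mem_insert_self i s)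
    · exact sum_mem fun j hj => hf j (Finset.mem_insert_of_mem hj)

theorem pull_mul {g : G} {a b : A} (ha : a ∈ (α.dom g).alg) (hb : b ∈ (α.dom g).alg) :
    α.pull g (a * b) = α.pull g a * α.pull g b := by
  rw [pull_of_mem α ha, pull_of_mem α hb, pull_of_mem α (mul_mem ha hb), ← α.inv_mul']
  rfl

theorem pull_star {g : G} {a : A} (ha : a ∈ (α.dom g).alg) :
    α.pull g (star a) = star (α.pull g a) := by
  rw [pull_of_mem α ha, pull_of_mem α (star_mem ha), ← α.inv_star]
  rfl

theorem norm_pull_le (g : G) (a : A) : ‖α.pull g a‖ ≤ ‖a‖ := by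
  unfold pull
  split_ifs with h
  · exact NonUnitalStarAlgHom.norm_apply_le (α.act g⁻¹) ⟨a, _⟩
  · rw [norm_zero]; exact norm_nonneg _

/-- The order of the indices is that of arrows, since `pull g` is `α_{g⁻¹}` and `h⁻¹g⁻¹ = (gh)⁻¹`.
-/
theorem pull_pull {g h : G} {a : A} (ha : a ∈ (α.dom g).alg)
    (hb : α.pull g a ∈ (α.dom h).alg) : α.pull h (α.pull g a) = α.pull (g * h) a := by
  have e := α.act_eq_pull (g := g⁻¹) rfl ⟨a, α.mem_congr (inv_inv g).symm ha⟩
  have h1 : (α.act g⁻¹ ⟨a, α.mem_congr (inv_inv g).symm ha⟩ : A) ∈ (α.dom h⁻¹⁻¹).alg := by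
    refine α.mem_congr (inv_inv h).symm ?_
    rw [e]; exact hb
  obtain ⟨h2, h3⟩ := α.act_mul h⁻¹ g⁻¹ _ h1
  rw [act_eq_pull α (mul_inv_rev g h).symm, act_eq_pull α rfl] at h3
  change α.pull (g * h) a = α.pull h (α.act g⁻¹ _ : A) at h3
  rw [h3, e]

theorem pull_one (a : A) : α.pull 1 a = a := by
  have ha : a ∈ (α.dom 1).alg := by rw [α.dom_one]; trivial
  rw [pull_of_mem α ha]
  unfold inv
  rw [α.act_congr inv_one _ ⟨a, α.mem_congr (by simp) ha⟩ rfl, α.act_one]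

theorem pull_inv_pull {g : G} {a : A} (ha : a ∈ (α.dom g).alg) : α.pull g⁻¹ (α.pull g a) = a := by
  rw [α.pull_pull ha (α.pull_mem g a), mul_inv_cancel, pull_one]

theorem pull_pull_inv {g : G} {a : A} (ha : a ∈ (α.dom g⁻¹).alg) :
    α.pull g (α.pull g⁻¹ a) = a := by
  rw [α.pull_pull ha (α.pull_inv_mem g a), inv_mul_cancel, pull_one]

variable {α}

theorem mem_dom_of_mem_tuple {σ : Tuple G n} {a : A} (ha : a ∈ (α.tupleIdeal σ).alg) {g : G}
    (hg : g ∈ σ) : a ∈ (α.dom g).alg := (α.mem_tupleIdeal σ a).1 ha g hg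

theorem pull_mem_tuple {σ : Tuple G n} {a : A} (ha : a ∈ (α.tupleIdeal σ).alg) {g : G}
    (hg : g ∈ σ) : α.pull g a ∈ (α.tupleIdeal (σ.src g)).alg := by
  rw [pull_of_mem α (mem_dom_of_mem_tuple ha hg), Tuple.src_eq hg]
  exact HasDecomposition.act_tupleIdeal_mem σ g⁻¹ (by rwa [inv_inv]) _ ha

theorem pull_inv_mem_tuple {σ : Tuple G n} {a : A} {g : G} (hg : g ∈ σ)
    (ha : a ∈ (α.tupleIdeal (σ.src g)).alg) : α.pull g⁻¹ a ∈ (α.tupleIdeal σ).alg := by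
  have := pull_mem_tuple ha (Tuple.inv_mem_src hg)
  rwa [Tuple.src_src_inv hg] at this

theorem pull_pull_tuple {σ : Tuple G n} {a : A} (ha : a ∈ (α.tupleIdeal σ).alg) {g k : G}
    (hg : g ∈ σ) (hk : k ∈ σ.src g) : α.pull k (α.pull g a) = α.pull (g * k) a :=
  α.pull_pull (mem_dom_of_mem_tuple ha hg) (mem_dom_of_mem_tuple (pull_mem_tuple ha hg) hk)

theorem IsFixed.pull_mul_left {a : A} (ha : α.IsFixed a) {g : G} {b : A}
    (hb : b ∈ (α.dom g).alg) : α.pull g (a * b) = a * α.pull g b := by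
  rw [pull_of_mem α hb, pull_of_mem α ((α.dom g).mul_mem_left a hb)]
  exact ha g ⟨b, hb⟩

theorem isFixed_of_pull {a : A}
    (ha : ∀ (g : G), ∀ b ∈ (α.dom g).alg, α.pull g (a * b) = a * α.pull g b) : α.IsFixed a := by
  intro g b
  have := ha g b b.2
  rwa [pull_of_mem α b.2, pull_of_mem α ((α.dom g).mul_mem_left a b.2)] at this

/-! ### Components -/

namespace HasDecomposition

variable (h : α.HasDecomposition n)

/-- The component is defined by its products with `A_τ` on the right; associativity, tested against
`A_τ`, gives the left-handed version. -/
theorem mul_component (τ : Tuple G n) (a c : A) (hc : c ∈ (α.tupleIdeal τ).alg) :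
    c * a = c * h.component τ a := by
  refine tuple_unique (α.tupleIdeal τ) ((α.tupleIdeal τ).mul_mem_right a hc)
    ((α.tupleIdeal τ).mul_mem_right _ hc) fun d hd => ?_
  rw [mul_assoc, mul_assoc, h.component_mul τ a d hd]

theorem map_mul_component (τ : Tuple G n) (a b : A) :
    h.component τ (a * b) = h.component τ a * h.component τ b :=
  h.component_eq τ (mul_mem (h.component_mem τ a) (h.component_mem τ b)) fun c hc => by
    rw [mul_assoc, h.component_mul τ b c hc,
      h.component_mul τ a _ (mul_mem (h.component_mem τ b) hc), mul_assoc]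

theorem map_star_component (τ : Tuple G n) (a : A) :
    h.component τ (star a) = star (h.component τ a) :=
  h.component_eq τ (star_mem (h.component_mem τ a)) fun c hc => by
    rw [← star_star c, ← star_mul, ← star_mul, h.mul_component τ a _ (star_mem hc)]

theorem component_zero (τ : Tuple G n) : h.component τ 0 = 0 := h.component_self τ (zero_mem _)

theorem component_sum {ι : Type*} (τ : Tuple G n) (s : Finset ι) (f : ι → A) :
    h.component τ (∑ i ∈ s, f i) = ∑ i ∈ s, h.component τ (f i) :=
  map_sum (h.componentL τ) f s

/-- An element is determined by its components. -/
theorem ext_component {a b : A} (hab : ∀ τ : Tuple G n, h.component τ a = h.component τ b) :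
    a = b := by
  -- The right annihilator of `a - b` is closed and contains each `A_σ`, hence it is all of `A` and
  -- contains `(a - b)⋆`.
  let S : Submodule ℂ A := LinearMap.ker (LinearMap.mulLeft ℂ (a - b))
  have hS : IsClosed (S : Set A) := by
    have : (S : Set A) = {c | (a - b) * c = 0} := rfl
    rw [this]
    exact isClosed_eq (continuous_const.mul continuous_id) continuous_const
  have hle : (⨆ σ : Tuple G n, (α.tupleIdeal σ).toSubmodule) ≤ S := by
    refine iSup_le fun σ c hc => ?_
    change (a - b) * c = 0
    rw [sub_mul, h.component_mul σ a c hc, h.component_mul σ b c hc, hab, sub_self]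
  have := Submodule.topologicalClosure_minimal _ hle hS
  rw [h.dense] at this
  have h1 : (a - b) * star (a - b) = 0 :=
    this (show star (a - b) ∈ (⊤ : Submodule ℂ A) from trivial)
  exact sub_eq_zero.1 ((CStarRing.mul_star_self_eq_zero_iff _).1 h1)

theorem component_eq_zero_of_dom {σ : Tuple G n} {g : G} (hg : g ∉ σ) {a : A}
    (ha : a ∈ (α.dom g).alg) : h.component σ a = 0 :=
  h.eq_zero hg (h.component_mem σ a) (h.component_mem_dom σ ha)

/-- Equivariance of the components: each element of `A_{g⁻¹σ}` is the image of an element of `A_σ`,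
so the defining property of `π_σ` can be transported along the arrow. -/
theorem component_pull {σ : Tuple G n} {g : G} (hg : g ∈ σ) {a : A} (ha : a ∈ (α.dom g).alg) :
    h.component (σ.src g) (α.pull g a) = α.pull g (h.component σ a) := by
  refine h.component_eq _ (pull_mem_tuple (h.component_mem σ a) hg) fun c hc => ?_
  have hd := pull_inv_mem_tuple hg hc
  have hdg := mem_dom_of_mem_tuple hd hg
  have e : c = α.pull g (α.pull g⁻¹ c) :=
    (α.pull_pull_inv (mem_dom_of_mem_tuple hc (Tuple.inv_mem_src hg))).symm
  rw [e, ← α.pull_mul ha hdg, ← α.pull_mul (h.component_mem_dom σ ha) hdg,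
    ← h.component_mul σ a _ hd]

/-- Here `a` need not lie in `A_g`; invariance of `a` replaces this. Together with the converse
below, it reduces invariance to a condition on arrows. -/
theorem pull_component {a : A} (ha : α.IsFixed a) {σ : Tuple G n} {g : G} (hg : g ∈ σ) :
    α.pull g (h.component σ a) = h.component (σ.src g) a := by
  refine (h.component_eq _ (pull_mem_tuple (h.component_mem σ a) hg) fun c hc => ?_).symm
  have hd := pull_inv_mem_tuple hg hc
  have hdg := mem_dom_of_mem_tuple hd hg
  have e : c = α.pull g (α.pull g⁻¹ c) :=
    (α.pull_pull_inv (mem_dom_of_mem_tuple hc (Tuple.inv_mem_src hg))).symm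
  rw [e, ← α.pull_mul (mem_dom_of_mem_tuple (h.component_mem σ a) hg) hdg,
    ← h.component_mul σ a _ hd, ha.pull_mul_left hdg]

theorem isFixed_of_pull_component {a : A} (ha : ∀ (σ : Tuple G n), ∀ g ∈ σ,
    α.pull g (h.component σ a) = h.component (σ.src g) a) : α.IsFixed a := by
  refine isFixed_of_pull fun g b hb => h.ext_component fun σ => ?_
  -- Both sides lie in `A_{g⁻¹}`, so only tuples containing `g⁻¹` matter, and those are the sources
  -- `g⁻¹ρ` of arrows `(ρ, g)`.
  by_cases hg : g⁻¹ ∈ σ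
  · have hg' : g ∈ σ.src g⁻¹ := by simpa using Tuple.inv_mem_src hg
    have e : (σ.src g⁻¹).src g = σ := by simpa using Tuple.src_src_inv hg
    rw [h.map_mul_component]
    generalize σ.src g⁻¹ = ρ at hg' e
    subst e
    rw [h.component_pull hg' ((α.dom g).mul_mem_left a hb), h.component_pull hg' hb,
      h.map_mul_component, α.pull_mul (mem_dom_of_mem_tuple (h.component_mem _ _) hg')
        (mem_dom_of_mem_tuple (h.component_mem _ _) hg'), ha _ _ hg']
  · rw [h.component_eq_zero_of_dom hg (α.pull_mem g _),
      h.component_eq_zero_of_dom hg ((α.dom g⁻¹).mul_mem_left a (α.pull_mem g b))]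

end HasDecomposition

/-! ### Elements of the crossed product -/

variable (α)

open Classical in
/-- The element `a δ_g` of the crossed product for `a ∈ A_g`, and zero for `a ∉ A_g`. -/
noncomputable def single (g : G) (a : A) : α.CrossedProduct :=
  if ha : a ∈ (α.dom g).alg then α.delta g ⟨a, ha⟩ else 0

theorem single_of_mem {g : G} {a : A} (ha : a ∈ (α.dom g).alg) :
    α.single g a = α.delta g ⟨a, ha⟩ := dif_pos ha

theorem delta_eq_single {g k : G} (hg : g = k) (a : (α.dom g).alg) :
    α.delta g a = α.single k a := by
  subst hg
  exact (α.single_of_mem a.2).symm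

theorem single_zero (g : G) : α.single g 0 = 0 := by
  rw [single_of_mem α (zero_mem _)]
  exact map_zero (α.delta g)

theorem single_add {g : G} {a b : A} (ha : a ∈ (α.dom g).alg) (hb : b ∈ (α.dom g).alg) :
    α.single g (a + b) = α.single g a + α.single g b := by
  rw [single_of_mem α ha, single_of_mem α hb, single_of_mem α (add_mem ha hb), ← map_add]
  rfl

theorem single_smul {g : G} (c : ℂ) {a : A} (ha : a ∈ (α.dom g).alg) :
    α.single g (c • a) = c • α.single g a := by
  rw [single_of_mem α ha, single_of_mem α (SMulMemClass.smul_mem c ha), ← map_smul]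
  rfl

theorem single_sum {ι : Type*} (s : Finset ι) (f : ι → A) {g : G}
    (hf : ∀ i ∈ s, f i ∈ (α.dom g).alg) :
    α.single g (∑ i ∈ s, f i) = ∑ i ∈ s, α.single g (f i) := by
  classical
  induction s using Finset.induction_on with
  | empty => simp [single_zero]
  | insert i s hi ih =>
    rw [Finset.sum_insert hi, Finset.sum_insert hi, single_add, ih]
    · exact fun j hj => hf j (Finset.mem_insert_of_mem hj)
    · exact hf i (Finset.mem_insert_self i s)
    · exact sum_mem fun j hj => hf j (Finset.mem_insert_of_mem hj)

theorem single_mul {g k : G} {a b : A} (ha : a ∈ (α.dom g).alg) (hb : b ∈ (α.dom k).alg) :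
    α.single g a * α.single k b = α.single (g * k) (α.pull g⁻¹ (α.pull g a * b)) := by
  rw [single_of_mem α ha, single_of_mem α hb, delta_mul, delta_eq_single α rfl]
  congr 1
  change (α.act g _ : A) = _
  rw [act_eq_pull α (inv_inv g).symm, pull_of_mem α ha]

theorem star_single {g : G} {a : A} (ha : a ∈ (α.dom g).alg) :
    star (α.single g a) = α.single g⁻¹ (α.pull g (star a)) := by
  rw [single_of_mem α ha, star_delta, delta_eq_single α rfl, pull_of_mem α (star_mem ha)]
  rfl

theorem norm_delta_le (g : G) (a : (α.dom g).alg) : ‖α.delta g a‖ ≤ ‖a‖ :=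
  lp.norm_le_of_forall_le (norm_nonneg a) fun ρ => ρ.norm_le g a

theorem norm_single_le (g : G) (a : A) : ‖α.single g a‖ ≤ ‖a‖ := by
  unfold single
  split_ifs with h
  · exact α.norm_delta_le g _
  · rw [norm_zero]; exact norm_nonneg _

end PartialAction

/-! ### Strict limits and corners -/

section Limits

open Filter Topology

/-- For eventually contractive linear maps into a complete space, the vectors on which they converge
form a closed subspace. -/
theorem exists_clm_tendsto {ι E F : Type*} [NormedAddCommGroup E] [NormedSpace ℂ E]
    [NormedAddCommGroup F] [NormedSpace ℂ F] [CompleteSpace F] {l : Filter ι} [l.NeBot]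
    (T : ι → E →ₗ[ℂ] F) (hT : ∀ᶠ i in l, ∀ x, ‖T i x‖ ≤ ‖x‖) {K : Set E}
    (hK : (Submodule.span ℂ K).topologicalClosure = ⊤)
    (hlim : ∀ x ∈ K, ∃ y, Tendsto (fun i => T i x) l (𝓝 y)) :
    ∃ L : E →L[ℂ] F, ∀ x, Tendsto (fun i => T i x) l (𝓝 (L x)) := by
  let W : Submodule ℂ E :=
    { carrier := {x | ∃ y, Tendsto (fun i => T i x) l (𝓝 y)}
      zero_mem' := ⟨0, by simp⟩
      add_mem' := by
        rintro a b ⟨y, hy⟩ ⟨w, hw⟩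
        exact ⟨y + w, by simpa using hy.add hw⟩
      smul_mem' := by
        rintro r a ⟨y, hy⟩
        exact ⟨r • y, by simpa using hy.const_smul r⟩ }
  have hW : IsClosed (W : Set E) := by
    refine isClosed_of_closure_subset fun x hx => ?_
    refine cauchy_map_iff_exists_tendsto.1 (Metric.cauchy_iff.2 ⟨inferInstance, fun ε hε => ?_⟩)
    -- One `ε / 4` pays for replacing `x` by `y`, one for the convergence at `y`: eventually `T i x`
    -- is in the ball of radius `ε / 2` about `w`, any two points of which are less than `ε` apart.
    obtain ⟨y, ⟨w, hw⟩, hxy⟩ := Metric.mem_closure_iff.1 hx (ε / 4) (by linarith)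
    refine ⟨Metric.ball w (ε / 2), ?_, fun a ha b hb => ?_⟩
    · rw [mem_map]
      filter_upwards [hT, Metric.tendsto_nhds.1 hw (ε / 4) (by linarith)] with i hi hiw
      have h1 := hi (x - y)
      rw [map_sub, ← dist_eq_norm, ← dist_eq_norm] at h1
      have h2 := dist_triangle (T i x) (T i y) w
      change dist (T i x) w < ε / 2
      linarith
    · have := dist_triangle_right a b w
      rw [Metric.mem_ball] at ha hb
      linarith
  have htop : ∀ x, ∃ y, Tendsto (fun i => T i x) l (𝓝 y) := fun x => by
    have := Submodule.topologicalClosure_minimal _ (Submodule.span_le.2 hlim : _ ≤ W) hW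
    rw [hK] at this
    exact this trivial
  choose L hL using htop
  exact ⟨LinearMap.mkContinuous
    { toFun := L
      map_add' := fun x y => tendsto_nhds_unique (hL (x + y)) (by simpa using (hL x).add (hL y))
      map_smul' := fun r x =>
        tendsto_nhds_unique (hL (r • x)) (by simpa using (hL x).const_smul r) } 1 fun x => by
      rw [one_mul]
      exact le_of_tendsto (hL x).norm (hT.mono fun i hi => hi x), hL⟩

theorem tendsto_of_dense_span {ι E F : Type*} [NormedAddCommGroup E] [NormedSpace ℂ E]
    [NormedAddCommGroup F] [NormedSpace ℂ F] [CompleteSpace F] {l : Filter ι} [l.NeBot]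
    (T : ι → E →ₗ[ℂ] F) (hT : ∀ᶠ i in l, ∀ x, ‖T i x‖ ≤ ‖x‖) {K : Set E}
    (hK : (Submodule.span ℂ K).topologicalClosure = ⊤) (S : E →L[ℂ] F)
    (hlim : ∀ x ∈ K, Tendsto (fun i => T i x) l (𝓝 (S x))) (x : E) :
    Tendsto (fun i => T i x) l (𝓝 (S x)) := by
  obtain ⟨L, hL⟩ := exists_clm_tendsto T hT hK fun x hx => ⟨_, hlim x hx⟩
  have : L = S := ContinuousLinearMap.ext_on
    (by rw [dense_iff_closure_eq, ← Submodule.topologicalClosure_coe, hK]; rfl)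
    fun x hx => tendsto_nhds_unique (hL x) (hlim x hx)
  exact this ▸ hL x

/-- The spectral order is used only inside the proof, so that no order structure appears in what
follows. -/
theorem exists_approximateUnit (F : Type*) [NonUnitalCStarAlgebra F] :
    ∃ l : Filter F, l.NeBot ∧ (∀ᶠ e in l, IsSelfAdjoint e) ∧ (∀ᶠ e in l, ‖e‖ ≤ 1) ∧
      ∀ a, Tendsto (fun e => e * a) l (𝓝 a) := by
  let _ := CStarAlgebra.spectralOrder F
  have := CStarAlgebra.spectralOrderedRing F
  have h := CStarAlgebra.increasingApproximateUnit F
  exact ⟨_, h.neBot, h.eventually_isSelfAdjoint, h.eventually_norm, h.tendsto_mul_right⟩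

variable {F D : Type*} [NonUnitalCStarAlgebra F] [NonUnitalCStarAlgebra D]

theorem eq_of_forall_mul_eq {x y : D} (h : ∀ w, x * w = y * w) : x = y := by
  have h1 := h (star (x - y))
  rw [← sub_eq_zero, ← sub_mul] at h1
  exact sub_eq_zero.1 ((CStarRing.mul_star_self_eq_zero_iff _).1 h1)

/-- An injective `⋆`-homomorphism `c` for which `c(e_λ)` converges strictly to a projection `p`
with `p D p ⊆ c(F)` is a corner embedding. -/
theorem exists_isCornerBy (c : F →⋆ₙₐ[ℂ] D) (hc : Function.Injective c) {l : Filter F} [l.NeBot]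
    (hsa : ∀ᶠ e in l, IsSelfAdjoint e) (hn : ∀ᶠ e in l, ‖e‖ ≤ 1)
    (hl : ∀ a, Tendsto (fun e => e * a) l (𝓝 a)) {K : Set D}
    (hK : (Submodule.span ℂ K).topologicalClosure = ⊤)
    (hlim : ∀ x ∈ K, ∃ y, Tendsto (fun e => c e * x) l (𝓝 y) ∧
      ∃ b, Tendsto (fun e => y * c e) l (𝓝 (c b))) :
    ∃ p : 𝓜(ℂ, D), IsCornerBy p (Set.range c) ∧
      ∀ x, Tendsto (fun e => c e * x) l (𝓝 (p.fst x)) := by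
  have hcc : Continuous c := (NonUnitalStarAlgHom.isometry c hc).continuous
  obtain ⟨L, hL⟩ := exists_clm_tendsto (l := l) (fun e => LinearMap.mulLeft ℂ (c e))
    (hn.mono fun e he x => by
      have h1 := norm_mul_le (c e) x
      have h2 := NonUnitalStarAlgHom.norm_apply_le c e
      change ‖c e * x‖ ≤ _
      nlinarith [norm_nonneg x]) hK fun x hx => (hlim x hx).imp fun y hy => hy.1
  change ∀ x, Tendsto (fun e => c e * x) l (𝓝 (L x)) at hL
  -- The right half of the multiplier is `x ↦ L(x⋆)⋆`; as the `e` are self-adjoint, it is the limit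
  -- of `x c(e)`.
  let R : D →L[ℂ] D := (((starₗᵢ ℂ : D ≃ₗᵢ⋆[ℂ] D) : D →L⋆[ℂ] D).comp L).comp
    ((starₗᵢ ℂ : D ≃ₗᵢ⋆[ℂ] D) : D →L⋆[ℂ] D)
  have hRdef : ∀ x, R x = star (L (star x)) := fun x => rfl
  have hR : ∀ x, Tendsto (fun e => x * c e) l (𝓝 (R x)) := fun x => by
    refine ((continuous_star.tendsto _).comp (hL (star x))).congr' ?_
    filter_upwards [hsa] with e he
    change star (c e * star x) = _
    rw [star_mul, star_star, ← map_star, he.star_eq]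
  have hcent : ∀ x y, R x * y = x * L y := fun x y => by
    refine tendsto_nhds_unique ((hR x).mul_const y) ?_
    simp_rw [mul_assoc]
    exact (hL y).const_mul x
  have hmul : ∀ x y, L (x * y) = L x * y := fun x y => by
    refine tendsto_nhds_unique (hL _) ?_
    simp_rw [← mul_assoc]
    exact (hL x).mul_const y
  have hLc : ∀ a, L (c a) = c a := fun a => by
    refine tendsto_nhds_unique (hL _) ?_
    simp_rw [← map_mul]
    exact (hcc.tendsto _).comp (hl a)
  have hRc : ∀ a, R (c a) = c a := fun a => by
    rw [hRdef, ← map_star c, hLc, map_star c, star_star]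
  have hLL : ∀ x, L (L x) = L x := fun x => by
    refine tendsto_nhds_unique ((L.continuous.tendsto _).comp (hL x)) ?_
    refine (hL x).congr fun e => ?_
    rw [Function.comp_apply, hmul, hLc]
  let p : 𝓜(ℂ, D) := ⟨(L, R), hcent⟩
  have hpL : ∀ x, p.fst x = L x := fun _ => rfl
  have hpR : ∀ x, p.snd x = R x := fun _ => rfl
  refine ⟨p, ⟨⟨?_, ?_⟩, fun b => ⟨?_, ?_⟩⟩, hL⟩
  · refine DoubleCentralizer.ext _ _ _ _ (Prod.ext ?_ ?_)
    · exact ContinuousLinearMap.ext hLL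
    · refine ContinuousLinearMap.ext fun x => ?_
      change R (R x) = R x
      rw [hRdef, hRdef, star_star, hLL]
  · refine DoubleCentralizer.ext _ _ _ _ (Prod.ext ?_ ?_)
    · refine ContinuousLinearMap.ext fun x => ?_
      change star (R (star x)) = L x
      rw [hRdef, star_star, star_star]
    · exact ContinuousLinearMap.ext fun x => rfl
  · rintro ⟨a, rfl⟩
    refine ⟨c a, DoubleCentralizer.ext _ _ _ _ (Prod.ext ?_ ?_)⟩
    · refine ContinuousLinearMap.ext fun x => ?_
      change c a * x = L (c a * L x)
      rw [hmul, hLc, ← hcent, hRc]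
    · refine ContinuousLinearMap.ext fun x => ?_
      change x * c a = R (R x * c a)
      rw [hcent, hLc, hRdef, star_mul, hmul, ← map_star c, hLc, star_mul, map_star c, star_star,
        star_star]
  · rintro ⟨y, hy⟩
    -- `R (L y)` is `p y p` realised inside `D`.
    have e : b = R (L y) := eq_of_forall_mul_eq fun w => by
      have h1 := congrArg (fun q : 𝓜(ℂ, D) => q.fst w) hy
      change b * w = L (y * L w) at h1
      rw [h1, hmul, hcent]
    rw [e]
    -- The `y` with `p y p` in the image of `c` form a closed subspace, because an injective
    -- `⋆`-homomorphism is isometric and has closed range. It therefore suffices to check `K`.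
    let W : Submodule ℂ D := (LinearMap.range (c : F →ₗ[ℂ] D)).comap (R.comp L : D →ₗ[ℂ] D)
    have hW : IsClosed (W : Set D) :=
      (NonUnitalStarAlgHom.isometry c hc).isClosedEmbedding.isClosed_range.preimage
        (R.comp L).continuous
    have hKW : K ⊆ W := fun x hx => by
      obtain ⟨y, hy, b, hb⟩ := hlim x hx
      refine ⟨b, ?_⟩
      change c b = R (L x)
      rw [tendsto_nhds_unique (hL x) hy]
      exact tendsto_nhds_unique hb (hR y)
    have := Submodule.topologicalClosure_minimal _ (Submodule.span_le.2 hKW) hW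
    rw [hK] at this
    exact this (show y ∈ (⊤ : Submodule ℂ D) from trivial)

end Limits

namespace PartialAction

variable {G : Type v} [Group G] {A : Type u} [NonUnitalCStarAlgebra A] {α : PartialAction G A}
  {n : ℕ}

/-! ### Density -/

variable (α) in
-- The linear span of the `a δ_g` is already closed under products and adjoints, so it contains the
-- `⋆`-algebra whose closure defines the crossed product.
theorem span_delta_dense : (Submodule.span ℂ {x : α.CrossedProduct |
    ∃ (g : G) (a : (α.dom g).alg), x = α.delta g a}).topologicalClosure = ⊤ := by
  set K : Set α.CrossedProduct := {x | ∃ (g : G) (a : (α.dom g).alg), x = α.delta g a}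
  let W := Submodule.span ℂ K
  have hmul : ∀ x ∈ W, ∀ y ∈ W, x * y ∈ W := fun x hx y hy => by
    induction hx using Submodule.span_induction with
    | zero => rw [zero_mul]; exact zero_mem _
    | add a b _ _ iha ihb => rw [add_mul]; exact add_mem iha ihb
    | smul r a _ ih => rw [smul_mul_assoc]; exact W.smul_mem r ih
    | mem x hx =>
      obtain ⟨g, a, rfl⟩ := hx
      induction hy using Submodule.span_induction with
      | zero => rw [mul_zero]; exact zero_mem _
      | add a b _ _ iha ihb => rw [mul_add]; exact add_mem iha ihb
      | smul r a _ ih => rw [mul_smul_comm]; exact W.smul_mem r ih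
      | mem y hy =>
        obtain ⟨k, b, rfl⟩ := hy
        exact Submodule.subset_span ⟨g * k, _, α.delta_mul g k a b⟩
  have hstar : ∀ x ∈ W, star x ∈ W := fun x hx => by
    induction hx using Submodule.span_induction with
    | zero => rw [star_zero]; exact zero_mem _
    | add a b _ _ iha ihb => rw [star_add]; exact add_mem iha ihb
    | smul r a _ ih => rw [star_smul]; exact W.smul_mem _ ih
    | mem x hx =>
      obtain ⟨g, a, rfl⟩ := hx
      exact Submodule.subset_span ⟨g⁻¹, _, α.star_delta g a⟩
  let val : α.CrossedProduct → lp (fun ρ : Rep α => ρ.B) ∞ := Subtype.val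
  let Q : NonUnitalStarSubalgebra ℂ (lp (fun ρ : Rep α => ρ.B) ∞) :=
    { carrier := val '' W
      zero_mem' := ⟨0, zero_mem W, rfl⟩
      add_mem' := by
        rintro _ _ ⟨x, hx, rfl⟩ ⟨y, hy, rfl⟩
        exact ⟨x + y, add_mem hx hy, rfl⟩
      mul_mem' := by
        rintro _ _ ⟨x, hx, rfl⟩ ⟨y, hy, rfl⟩
        exact ⟨x * y, hmul x hx y hy, rfl⟩
      smul_mem' := by
        rintro r _ ⟨x, hx, rfl⟩
        exact ⟨r • x, W.smul_mem r hx, rfl⟩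
      star_mem' := by
        rintro _ ⟨x, hx, rfl⟩
        exact ⟨star x, hstar x hx, rfl⟩ }
  have hle : NonUnitalStarAlgebra.adjoin ℂ {y | ∃ (g : G) (a : (α.dom g).alg),
      y = α.deltaAux g a} ≤ Q := NonUnitalStarAlgebra.adjoin_le (by
    rintro _ ⟨g, a, rfl⟩
    exact ⟨α.delta g a, Submodule.subset_span ⟨g, a, rfl⟩, rfl⟩)
  refine eq_top_iff.2 fun x _ => ?_
  have h1 : val x ∈ closure (val '' W) := closure_mono hle x.2
  exact closure_subtype.2 h1

namespace HasDecomposition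

variable (h : α.HasDecomposition n)

theorem component_sum_component (s : Finset (Tuple G n)) (σ : Tuple G n) (a : A)
    [Decidable (σ ∈ s)] :
    h.component σ (∑ ρ ∈ s, h.component ρ a) = if σ ∈ s then h.component σ a else 0 := by
  rw [h.component_sum]
  split_ifs with hσ
  · rw [Finset.sum_eq_single_of_mem σ hσ, h.component_self σ (h.component_mem σ a)]
    exact fun ρ _ hne => h.component_of_ne hne (h.component_mem ρ a)
  · exact Finset.sum_eq_zero fun ρ hρ =>
      h.component_of_ne (by rintro rfl; exact hσ hρ) (h.component_mem ρ a)

/-- If `x` is the partial sum, then `a x⋆ = x x⋆`, whence `‖x‖² ≤ ‖a‖ ‖x‖`. The bound is uniform in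
`s`. -/
theorem norm_sum_component_le (s : Finset (Tuple G n)) (a : A) :
    ‖∑ σ ∈ s, h.component σ a‖ ≤ ‖a‖ := by
  classical
  set x := ∑ σ ∈ s, h.component σ a with hx
  have h2 : a * star x = x * star x := by
    rw [hx, star_sum, Finset.mul_sum, Finset.mul_sum]
    refine Finset.sum_congr rfl fun σ hσ => ?_
    have hm := star_mem (h.component_mem σ a)
    rw [h.component_mul σ a _ hm, h.component_mul σ (∑ σ ∈ s, h.component σ a) _ hm,
      h.component_sum_component, if_pos hσ]
  have h3 := norm_mul_le a (star x)
  rw [h2, CStarRing.norm_self_mul_star, norm_star] at h3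
  by_contra! hlt
  have := mul_lt_mul_of_pos_right hlt ((norm_nonneg _).trans_lt hlt)
  linarith

include h in
theorem span_tuple_dense :
    (Submodule.span ℂ {a : A | ∃ σ : Tuple G n, a ∈ (α.tupleIdeal σ).alg}).topologicalClosure
      = ⊤ := by
  rw [← top_le_iff, ← h.dense]
  exact Submodule.topologicalClosure_mono
    (iSup_le fun σ a ha => Submodule.subset_span ⟨σ, ha⟩)

/-- The finite partial sums are contractions, and on each `A_σ` they are eventually the identity. -/
theorem hasSum_component (a : A) : HasSum (fun σ => h.component σ a) a := by
  have key := tendsto_of_dense_span (l := Filter.atTop)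
    (fun s : Finset (Tuple G n) => ∑ σ ∈ s, (h.componentL σ : A →ₗ[ℂ] A))
    (Filter.Eventually.of_forall fun s x => ?_) h.span_tuple_dense (ContinuousLinearMap.id ℂ A)
    ?_ a
  · simp_rw [LinearMap.sum_apply] at key
    exact key
  · rw [LinearMap.sum_apply]
    exact h.norm_sum_component_le s x
  · rintro x ⟨σ, hx⟩
    have : HasSum (fun σ => h.component σ x) (h.component σ x) := hasSum_single σ fun ρ hρ =>
      h.component_of_ne hρ.symm hx
    rw [h.component_self σ hx] at this
    simp_rw [LinearMap.sum_apply]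
    exact this

/-- The projection of `A` onto the ideal of an orbit. -/
noncomputable def orbitPart (z : TupleOrbit G n) (a : A) : A :=
  ∑ σ ∈ z.members, h.component σ a

open Classical in
theorem component_orbitPart (z : TupleOrbit G n) (σ : Tuple G n) (a : A) :
    h.component σ (h.orbitPart z a) = if σ.orbit = z then h.component σ a else 0 := by
  unfold orbitPart
  rw [h.component_sum_component]
  simp only [TupleOrbit.mem_members]

theorem orbitPart_mem (z : TupleOrbit G n) (a : A) : h.orbitPart z a ∈ (h.orbitIdeal z).alg :=
  sum_mem fun σ hσ => mem_orbitSum (TupleOrbit.mem_members.1 hσ) (h.component_mem σ a)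

theorem component_of_mem_orbitIdeal {z : TupleOrbit G n} {a : A} (ha : a ∈ (h.orbitIdeal z).alg)
    {σ : Tuple G n} (hσ : σ.orbit ≠ z) : h.component σ a = 0 := by
  rw [h.eq_sum_component ha, h.component_sum]
  exact Finset.sum_eq_zero fun ρ _ =>
    h.component_of_ne (by rintro rfl; exact hσ ρ.2) (h.component_mem ρ.1 a)

theorem orbitPart_of_mem {z : TupleOrbit G n} {a : A} (ha : a ∈ (h.orbitIdeal z).alg) :
    h.orbitPart z a = a := by
  classical
  refine h.ext_component fun σ => ?_
  rw [h.component_orbitPart]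
  split_ifs with hσ
  · rfl
  · rw [h.component_of_mem_orbitIdeal ha hσ]

/-- The sum of the components is regrouped along the finite fibres of the orbit map. -/
theorem hasSum_orbitPart (a : A) : HasSum (fun z => h.orbitPart z a) a := by
  have h1 := (Equiv.sigmaFiberEquiv (Tuple.orbit (G := G) (n := n))).hasSum_iff.2
    (h.hasSum_component a)
  have h2 := h1.sigma fun z => hasSum_fintype _
  convert h2 using 1
  ext z
  exact Finset.sum_subtype z.members (fun _ => TupleOrbit.mem_members) _

theorem orbitPart_isFixed {a : A} (ha : α.IsFixed a) (z : TupleOrbit G n) :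
    α.IsFixed (h.orbitPart z a) := by
  classical
  refine h.isFixed_of_pull_component fun σ g hg => ?_
  rw [h.component_orbitPart, h.component_orbitPart, Tuple.orbit_src]
  split_ifs
  · exact h.pull_component ha hg
  · exact α.pull_zero g

variable (α n) in
/-- The elements `a δ_g` with `a ∈ A_σ` and `g ∈ σ`. -/
def homogeneous : Set α.CrossedProduct :=
  {x | ∃ (σ : Tuple G n) (g : G) (a : A), g ∈ σ ∧ a ∈ (α.tupleIdeal σ).alg ∧ x = α.single g a}

include h in
-- Expand the coefficient of `a δ_g` into its components; those at tuples not containing `g` vanish.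
theorem span_homogeneous_dense :
    (Submodule.span ℂ (homogeneous α n)).topologicalClosure = ⊤ := by
  rw [← top_le_iff, ← α.span_delta_dense]
  refine Submodule.topologicalClosure_minimal _ (Submodule.span_le.2 ?_)
    (Submodule.isClosed_topologicalClosure _)
  rintro _ ⟨g, a, rfl⟩
  let f : Finset (Tuple G n) → (α.dom g).alg := fun s =>
    ⟨∑ σ ∈ s, h.component σ a, sum_mem fun σ _ => h.component_mem_dom σ a.2⟩
  have hf : Filter.Tendsto f Filter.atTop (nhds a) := by
    rw [tendsto_subtype_rng]
    exact h.hasSum_component (a : A)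
  have hcont : Continuous (α.delta g) :=
    AddMonoidHomClass.continuous_of_bound (α.delta g) 1 fun x => by
      rw [one_mul]; exact α.norm_delta_le g x
  refine mem_closure_of_tendsto ((hcont.tendsto a).comp hf)
    (Filter.Eventually.of_forall fun s => ?_)
  change α.delta g (f s) ∈ Submodule.span ℂ (homogeneous α n)
  rw [delta_eq_single α rfl]
  change α.single g (∑ σ ∈ s, h.component σ a) ∈ _
  rw [α.single_sum _ _ fun σ _ => h.component_mem_dom σ a.2]
  refine sum_mem fun σ _ => ?_
  by_cases hg : g ∈ σ
  · exact Submodule.subset_span ⟨σ, g, _, hg, h.component_mem σ a, rfl⟩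
  · rw [h.component_eq_zero_of_dom hg a.2, single_zero]
    exact zero_mem _

end HasDecomposition

end PartialAction

/-! ### The fixed point algebra as a C⋆-algebra; products of arrows -/

namespace PartialAction

variable {G : Type v} [Group G] {A : Type u} [NonUnitalCStarAlgebra A] {α : PartialAction G A}
  {n : ℕ}

/-- For fixed `g` and `b`, both sides of the invariance condition are continuous in `a`. Closedness
makes `A^G` a C⋆-algebra, so that `⋆`-homomorphisms on it are automatically contractive. -/
theorem isClosed_fixedPoints (α : PartialAction G A) : IsClosed (α.fixedPoints : Set A) := by
  have e : (α.fixedPoints : Set A) = ⋂ (g : G) (b : (α.dom g).alg),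
      {a : A | α.pull g (a * b) = a * α.pull g b} := by
    ext a
    simp only [Set.mem_iInter]
    exact ⟨fun ha g b => IsFixed.pull_mul_left ha b.2,
      fun ha => isFixed_of_pull fun g b hb => ha g ⟨b, hb⟩⟩
  rw [e]
  refine isClosed_iInter fun g => isClosed_iInter fun b => ?_
  have hL : Continuous fun a : A => α.pull g (a * b) := by
    let L : A →+ A :=
      { toFun := fun a => α.pull g (a * b)
        map_zero' := by rw [zero_mul, pull_zero]
        map_add' := fun x y => by
          rw [add_mul, α.pull_add ((α.dom g).mul_mem_left x b.2) ((α.dom g).mul_mem_left y b.2)] }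
    refine AddMonoidHomClass.continuous_of_bound L ‖(b : A)‖ fun a => ?_
    rw [mul_comm]
    exact (α.norm_pull_le g _).trans (norm_mul_le _ _)
  exact isClosed_eq hL (continuous_id.mul continuous_const)

/-- The fixed point algebra is a C⋆-algebra. -/
@[reducible]
noncomputable def fixedPointsCStar (α : PartialAction G A) : NonUnitalCStarAlgebra α.fixedPoints :=
  NonUnitalStarSubalgebra.nonUnitalCStarAlgebra α.fixedPoints (h_closed := α.isClosed_fixedPoints)

theorem norm_fixedPoints_hom_le {D : Type*} [NonUnitalCStarAlgebra D]
    (c : α.fixedPoints →⋆ₙₐ[ℂ] D) (a : α.fixedPoints) : ‖c a‖ ≤ ‖(a : A)‖ :=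
  letI := α.fixedPointsCStar
  NonUnitalStarAlgHom.norm_apply_le c a

/-- The product of composable arrows: the second coefficient is carried back from the source `g⁻¹σ`
to the range `σ`. -/
theorem single_mul_tuple {σ : Tuple G n} {g k : G} {a b : A} (hg : g ∈ σ)
    (hk : k ∈ σ.src g) (ha : a ∈ (α.tupleIdeal σ).alg) (hb : b ∈ (α.tupleIdeal (σ.src g)).alg) :
    α.single g a * α.single k b = α.single (g * k) (a * α.pull g⁻¹ b) := by
  have hga := mem_dom_of_mem_tuple ha hg
  rw [α.single_mul hga (mem_dom_of_mem_tuple hb hk), α.pull_mul (α.pull_mem g a)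
    (mem_dom_of_mem_tuple hb (Tuple.inv_mem_src hg)), α.pull_inv_pull hga]

namespace HasDecomposition

variable (h : α.HasDecomposition n)

include h in
-- For non-composable arrows, the product formula contains a factor from `A_{g⁻¹σ} ∩ A_ρ = 0`.
theorem single_mul_of_ne {σ ρ : Tuple G n} {g k : G} {a b : A} (hg : g ∈ σ) (hk : k ∈ ρ)
    (hne : σ.src g ≠ ρ) (ha : a ∈ (α.tupleIdeal σ).alg) (hb : b ∈ (α.tupleIdeal ρ).alg) :
    α.single g a * α.single k b = 0 := by
  rw [α.single_mul (mem_dom_of_mem_tuple ha hg) (mem_dom_of_mem_tuple hb hk),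
    h.eq_zero_of_ne hne ((α.tupleIdeal _).mul_mem_right b (pull_mem_tuple ha hg))
      ((α.tupleIdeal ρ).mul_mem_left _ hb), pull_zero, single_zero]

/-! ### The corner map of an orbit -/

/-- The linear map `a ↦ 1/n ∑_{σ ∈ z} ∑_{g ∈ σ} π_σ(a) δ_g`. -/
noncomputable def orbitCorner (z : TupleOrbit G n) : A →ₗ[ℂ] α.CrossedProduct where
  toFun a := (n : ℂ)⁻¹ • ∑ σ ∈ z.members, ∑ g ∈ σ.1, α.single g (h.component σ a)
  map_add' a b := by
    rw [← smul_add, ← Finset.sum_add_distrib]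
    congr 1
    refine Finset.sum_congr rfl fun σ _ => ?_
    rw [← Finset.sum_add_distrib]
    refine Finset.sum_congr rfl fun g hg => ?_
    rw [h.component_add, α.single_add (mem_dom_of_mem_tuple (h.component_mem σ a) hg)
      (mem_dom_of_mem_tuple (h.component_mem σ b) hg)]
  map_smul' r a := by
    rw [RingHom.id_apply, smul_comm r]
    congr 1
    rw [Finset.smul_sum]
    refine Finset.sum_congr rfl fun σ _ => ?_
    rw [Finset.smul_sum]
    refine Finset.sum_congr rfl fun g hg => ?_
    rw [h.component_smul, α.single_smul _ (mem_dom_of_mem_tuple (h.component_mem σ a) hg)]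

theorem orbitCorner_apply (z : TupleOrbit G n) (a : A) : h.orbitCorner z a =
    (n : ℂ)⁻¹ • ∑ σ ∈ z.members, ∑ g ∈ σ.1, α.single g (h.component σ a) := rfl

open Classical in
theorem orbitCorner_orbitPart (z w : TupleOrbit G n) (a : A) :
    h.orbitCorner z (h.orbitPart w a) = if z = w then h.orbitCorner z a else 0 := by
  simp_rw [orbitCorner_apply, h.component_orbitPart]
  split_ifs with hzw
  · congr 1
    refine Finset.sum_congr rfl fun σ hσ => ?_
    rw [if_pos ((TupleOrbit.mem_members.1 hσ).trans hzw)]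
  · refine (congrArg _ (Finset.sum_eq_zero fun σ hσ => ?_)).trans (smul_zero _)
    rw [if_neg (fun e => hzw ((TupleOrbit.mem_members.1 hσ).symm.trans e))]
    exact Finset.sum_eq_zero fun g _ => α.single_zero g

theorem orbitCorner_of_mem_tuple {σ : Tuple G n} {a : A} (ha : a ∈ (α.tupleIdeal σ).alg) :
    h.orbitCorner σ.orbit a = (n : ℂ)⁻¹ • ∑ g ∈ σ.1, α.single g a := by
  rw [orbitCorner_apply, Finset.sum_eq_single_of_mem σ (TupleOrbit.mem_members.2 rfl),
    h.component_self σ ha]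
  intro ρ _ hne
  rw [h.component_of_ne hne.symm ha]
  exact Finset.sum_eq_zero fun g _ => α.single_zero g

open Classical in
-- Only the arrows with range `g⁻¹σ` compose with `(σ, g)`. Invariance of `b` carries its component
-- back to `σ`, and the composites are all arrows with range `σ`. The result does not involve `g`,
-- which is what makes the corner map multiplicative.
theorem single_mul_orbitCorner {σ : Tuple G n} {g : G} {a b : A} (hg : g ∈ σ)
    (ha : a ∈ (α.tupleIdeal σ).alg) (hb : α.IsFixed b) (z : TupleOrbit G n) :
    α.single g a * h.orbitCorner z b =
      if σ.orbit = z then (n : ℂ)⁻¹ • ∑ k ∈ σ.1, α.single k (a * b) else 0 := by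
  rw [orbitCorner_apply, mul_smul_comm, Finset.mul_sum]
  simp_rw [Finset.mul_sum]
  split_ifs with hz
  · congr 1
    rw [Finset.sum_eq_single_of_mem (σ.src g)
      (TupleOrbit.mem_members.2 ((σ.orbit_src g).trans hz))]
    -- The arrows with range `σ` are reindexed as `gk`, where `k` runs over `g⁻¹σ`.
    · rw [← h.pull_component hb hg, ← Tuple.src_src_inv hg,
        Tuple.sum_src (Tuple.inv_mem_src hg), inv_inv, Tuple.src_src_inv hg]
      refine Finset.sum_congr rfl fun k hk => ?_
      rw [single_mul_tuple hg hk ha (pull_mem_tuple (h.component_mem σ b) hg),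
        α.pull_inv_pull (mem_dom_of_mem_tuple (h.component_mem σ b) hg),
        ← h.mul_component σ b a ha]
    · intro ρ _ hne
      exact Finset.sum_eq_zero fun k hk =>
        h.single_mul_of_ne hg hk hne.symm ha (h.component_mem ρ b)
  · rw [Finset.sum_eq_zero, smul_zero]
    intro ρ hρ
    refine Finset.sum_eq_zero fun k hk => h.single_mul_of_ne hg hk ?_ ha (h.component_mem ρ b)
    rintro rfl
    exact hz ((σ.orbit_src g).symm.trans (TupleOrbit.mem_members.1 hρ))

/-- The adjoint turns the term of an arrow into the term of the inverse arrow, and inversion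
permutes the arrows of the orbit. -/
theorem star_orbitCorner {a : A} (ha : α.IsFixed a) (z : TupleOrbit G n) :
    star (h.orbitCorner z a) = h.orbitCorner z (star a) := by
  have hs : α.IsFixed (star a) := α.fixedPoints.star_mem' ha
  rw [orbitCorner_apply, orbitCorner_apply, star_smul, star_inv₀, star_natCast, star_sum,
    ← TupleOrbit.sum_swap z fun σ g => α.single g (h.component σ (star a))]
  congr 1
  refine Finset.sum_congr rfl fun σ _ => ?_
  rw [star_sum]
  refine Finset.sum_congr rfl fun g hg => ?_
  have hm := mem_dom_of_mem_tuple (h.component_mem σ a) hg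
  rw [α.star_single hm, ← h.map_star_component, h.pull_component hs hg]

open Classical in
-- For each `σ`, the `n` arrows with range `σ` contribute the same product, which cancels one of the
-- two factors `1/n`.
theorem orbitCorner_mul {a b : A} (hb : α.IsFixed b) (z w : TupleOrbit G n) :
    h.orbitCorner z a * h.orbitCorner w b = if z = w then h.orbitCorner z (a * b) else 0 := by
  rw [h.orbitCorner_apply z a, smul_mul_assoc, Finset.sum_mul]
  have key : ∀ σ ∈ z.members, (∑ g ∈ σ.1, α.single g (h.component σ a)) * h.orbitCorner w b =
      if z = w then ∑ g ∈ σ.1, α.single g (h.component σ (a * b)) else 0 := fun σ hσ => by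
    have hm := h.component_mem σ a
    rw [Finset.sum_mul, Finset.sum_congr rfl fun g hg =>
      h.single_mul_orbitCorner (show g ∈ σ from hg) hm hb w, TupleOrbit.mem_members.1 hσ,
      Finset.sum_const, σ.2.2]
    split_ifs
    · rw [← Nat.cast_smul_eq_nsmul ℂ, smul_smul, mul_inv_cancel₀ σ.natCast_ne_zero, one_smul,
        h.map_mul_component, h.mul_component σ b _ hm]
    · exact smul_zero n
  rw [Finset.sum_congr rfl key]
  split_ifs
  · rfl
  · rw [Finset.sum_const_zero, smul_zero]

/-- `a δ_h` is multiplied on the left by the average over the arrows with a given source. -/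
theorem orbitCorner_mul_single {ρ : Tuple G n} {k : G} {a b : A} (hk : k ∈ ρ)
    (hb : b ∈ (α.tupleIdeal ρ).alg) (ha : α.IsFixed a) :
    h.orbitCorner ρ.orbit a * α.single k b =
      (n : ℂ)⁻¹ • ∑ g ∈ ρ.1, α.single (g⁻¹ * k) (α.pull g (a * b)) := by
  rw [orbitCorner_apply, ← TupleOrbit.sum_swap _ fun σ g => α.single g (h.component σ a),
    smul_mul_assoc, Finset.sum_mul]
  congr 1
  rw [Finset.sum_eq_single_of_mem ρ (TupleOrbit.mem_members.2 rfl), Finset.sum_mul]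
  · refine Finset.sum_congr rfl fun g hg => ?_
    have hm := h.component_mem (ρ.src g) a
    have e := Tuple.src_src_inv (show g ∈ ρ from hg)
    have hgi := Tuple.inv_mem_src (show g ∈ ρ from hg)
    rw [single_mul_tuple hgi (by rwa [e]) hm (by rwa [e]), inv_inv, ← h.pull_component ha hg,
      ← α.pull_mul (mem_dom_of_mem_tuple (h.component_mem ρ a) hg) (mem_dom_of_mem_tuple hb hg),
      ← h.component_mul ρ a b hb]
  · intro σ _ hne
    rw [Finset.sum_mul]
    refine Finset.sum_eq_zero fun g hg => ?_
    refine h.single_mul_of_ne (Tuple.inv_mem_src hg) hk ?_ (h.component_mem _ a) hb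
    rwa [Tuple.src_src_inv hg]

theorem orbitCorner_mul_single_of_ne {ρ : Tuple G n} {z : TupleOrbit G n} (hz : ρ.orbit ≠ z)
    {k : G} {a b : A} (hk : k ∈ ρ) (hb : b ∈ (α.tupleIdeal ρ).alg) :
    h.orbitCorner z a * α.single k b = 0 := by
  rw [orbitCorner_apply, smul_mul_assoc, Finset.sum_mul, Finset.sum_eq_zero, smul_zero]
  intro σ hσ
  rw [Finset.sum_mul]
  refine Finset.sum_eq_zero fun g hg => h.single_mul_of_ne hg hk ?_ (h.component_mem _ a) hb
  rintro rfl
  exact hz ((σ.orbit_src g).trans (TupleOrbit.mem_members.1 hσ))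

/-! ### The corner map -/

/-- The sum of the corner maps of finitely many orbits. -/
noncomputable def partialCorner (s : Finset (TupleOrbit G n)) :
    α.fixedPoints →⋆ₙₐ[ℂ] α.CrossedProduct where
  toFun a := ∑ z ∈ s, h.orbitCorner z a
  map_smul' r a := by
    rw [MonoidHom.id_apply, Finset.smul_sum]
    exact Finset.sum_congr rfl fun z _ => map_smul _ _ _
  map_zero' := Finset.sum_eq_zero fun z _ => map_zero _
  map_add' a b := by
    rw [← Finset.sum_add_distrib]
    exact Finset.sum_congr rfl fun z _ => map_add _ _ _
  map_mul' a b := by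
    classical
    rw [Finset.sum_mul_sum]
    refine Finset.sum_congr rfl fun z hz => ?_
    simp_rw [h.orbitCorner_mul b.2]
    rw [Finset.sum_ite_eq, if_pos hz]
    rfl
  map_star' a := by
    rw [star_sum]
    exact Finset.sum_congr rfl fun z _ => (h.star_orbitCorner a.2 z).symm

/-- A finite sum of orbit corner maps is a `⋆`-homomorphism on `A^G`, hence contractive whatever the
number of orbits. The Cauchy criterion is inherited from the orbit decomposition of `a`. -/
theorem summable_orbitCorner {a : A} (ha : α.IsFixed a) :
    Summable fun z => h.orbitCorner z a := by
  classical
  rw [summable_iff_vanishing_norm]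
  intro ε hε
  obtain ⟨s, hs⟩ := summable_iff_vanishing_norm.1 (h.hasSum_orbitPart a).summable ε hε
  refine ⟨s, fun t ht => lt_of_le_of_lt ?_ (hs t ht)⟩
  -- Replacing `a` by its part over `t` leaves the finite sum unchanged and makes the norm bound
  -- small.
  let b : α.fixedPoints := ⟨∑ z ∈ t, h.orbitPart z a,
    sum_mem fun z _ => h.orbitPart_isFixed ha z⟩
  have e : ∑ z ∈ t, h.orbitCorner z a = h.partialCorner t b := by
    change _ = ∑ z ∈ t, h.orbitCorner z (∑ w ∈ t, h.orbitPart w a)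
    refine Finset.sum_congr rfl fun z hz => ?_
    rw [map_sum]
    simp_rw [h.orbitCorner_orbitPart]
    rw [Finset.sum_ite_eq, if_pos hz]
  rw [e]
  exact norm_fixedPoints_hom_le _ b

/-- The corner map `a ↦ ∑_z 1/n ∑_{σ ∈ z} ∑_{g ∈ σ} π_σ(a) δ_g`. -/
noncomputable def corner : α.fixedPoints →⋆ₙₐ[ℂ] α.CrossedProduct where
  toFun a := ∑' z, h.orbitCorner z a
  map_smul' r a := by
    rw [MonoidHom.id_apply, ← (h.summable_orbitCorner a.2).tsum_const_smul]
    exact tsum_congr fun z => map_smul _ _ _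
  map_zero' := by
    refine (tsum_congr fun z => ?_).trans tsum_zero
    exact map_zero _
  map_add' a b := by
    rw [← (h.summable_orbitCorner a.2).tsum_add (h.summable_orbitCorner b.2)]
    exact tsum_congr fun z => map_add _ _ _
  map_mul' a b := by
    classical
    rw [← (h.summable_orbitCorner a.2).tsum_mul_right]
    refine tsum_congr fun z => ?_
    rw [← (h.summable_orbitCorner b.2).tsum_mul_left]
    simp_rw [h.orbitCorner_mul b.2]
    rw [tsum_ite_eq']
    rfl
  map_star' a := by
    rw [tsum_star]
    exact tsum_congr fun z => (h.star_orbitCorner a.2 z).symm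

theorem hasSum_corner (a : α.fixedPoints) :
    HasSum (fun z => h.orbitCorner z a) (h.corner a) :=
  (h.summable_orbitCorner a.2).hasSum

theorem corner_mul_single {ρ : Tuple G n} {k : G} {b : A} (hk : k ∈ ρ)
    (hb : b ∈ (α.tupleIdeal ρ).alg) (a : α.fixedPoints) :
    h.corner a * α.single k b =
      (n : ℂ)⁻¹ • ∑ g ∈ ρ.1, α.single (g⁻¹ * k) (α.pull g (a * b)) := by
  rw [← h.orbitCorner_mul_single hk hb a.2]
  refine ((h.hasSum_corner a).mul_right _).unique (hasSum_single _ fun z hz => ?_)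
  exact h.orbitCorner_mul_single_of_ne hz.symm hk hb

theorem single_mul_corner {σ : Tuple G n} {g : G} {a : A} (hg : g ∈ σ)
    (ha : a ∈ (α.tupleIdeal σ).alg) (b : α.fixedPoints) :
    α.single g a * h.corner b = (n : ℂ)⁻¹ • ∑ k ∈ σ.1, α.single k (a * b) := by
  classical
  have e := h.single_mul_orbitCorner hg ha b.2 σ.orbit
  rw [if_pos rfl] at e
  rw [← e]
  refine ((h.hasSum_corner b).mul_left _).unique (hasSum_single _ fun z hz => ?_)
  rw [h.single_mul_orbitCorner hg ha b.2, if_neg hz.symm]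

end HasDecomposition

end PartialAction

namespace PartialAction

variable {G : Type v} [Group G] {A : Type u} [NonUnitalCStarAlgebra A] {α : PartialAction G A}
  {n : ℕ}

namespace HasDecomposition

variable (h : α.HasDecomposition n)

/-! ### Averages over an orbit -/

/-- The average over the arrows of the transformation groupoid of an orbit. -/
noncomputable def orbitAverage (z : TupleOrbit G n) (u : A) : A :=
  (n : ℂ)⁻¹ • ∑ σ ∈ z.members, ∑ k ∈ σ.1, α.pull k⁻¹ (h.component (σ.src k) u)

theorem pull_inv_component_mem {σ : Tuple G n} {k : G} (hk : k ∈ σ) (u : A) :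
    α.pull k⁻¹ (h.component (σ.src k) u) ∈ (α.tupleIdeal σ).alg :=
  pull_inv_mem_tuple hk (h.component_mem _ u)

theorem component_orbitAverage {z : TupleOrbit G n} {σ : Tuple G n} (hσ : σ.orbit = z) (u : A) :
    h.component σ (h.orbitAverage z u) =
      (n : ℂ)⁻¹ • ∑ k ∈ σ.1, α.pull k⁻¹ (h.component (σ.src k) u) := by
  unfold orbitAverage
  rw [h.component_smul, h.component_sum,
    Finset.sum_eq_single_of_mem σ (TupleOrbit.mem_members.2 hσ)]
  · rw [h.component_self]
    exact sum_mem fun k hk => h.pull_inv_component_mem hk u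
  · intro ρ _ hne
    exact h.component_of_ne hne (sum_mem fun k hk => h.pull_inv_component_mem hk u)

theorem component_orbitAverage_of_ne {z : TupleOrbit G n} {σ : Tuple G n} (hσ : σ.orbit ≠ z)
    (u : A) : h.component σ (h.orbitAverage z u) = 0 := by
  unfold orbitAverage
  rw [h.component_smul, h.component_sum, Finset.sum_eq_zero, smul_zero]
  intro ρ hρ
  refine h.component_of_ne ?_ (sum_mem fun k hk => h.pull_inv_component_mem hk u)
  rintro rfl
  exact hσ (TupleOrbit.mem_members.1 hρ)

/-- Applying an arrow `g` to the average at `σ` only reindexes the arrows, `k` becoming `g⁻¹k`,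
while their sources stay the same. -/
theorem orbitAverage_isFixed (z : TupleOrbit G n) (u : A) : α.IsFixed (h.orbitAverage z u) := by
  refine h.isFixed_of_pull_component fun σ g hg => ?_
  by_cases hz : σ.orbit = z
  · have hm : ∀ k ∈ σ.1, α.pull k⁻¹ (h.component (σ.src k) u) ∈ (α.tupleIdeal σ).alg :=
      fun k hk => h.pull_inv_component_mem hk u
    have hmg : ∀ k ∈ σ.1, α.pull k⁻¹ (h.component (σ.src k) u) ∈ (α.dom g).alg :=
      fun k hk => mem_dom_of_mem_tuple (hm k hk) hg
    rw [h.component_orbitAverage hz, h.component_orbitAverage ((σ.orbit_src g).trans hz),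
      α.pull_smul _ (sum_mem hmg), α.pull_sum _ _ hmg, Tuple.sum_src hg]
    congr 1
    refine Finset.sum_congr rfl fun k hk => ?_
    have hk' : k ∈ σ := hk
    have e : (σ.src g).src (g⁻¹ * k) = σ.src k := by
      rw [Tuple.src_src hg (by rwa [Tuple.mem_src hg, mul_inv_cancel_left]), mul_inv_cancel_left]
    rw [e, pull_pull_tuple (h.component_mem _ u) (Tuple.inv_mem_src hk')
      (by rwa [Tuple.src_src_inv hk']), mul_inv_rev, inv_inv]
  · rw [h.component_orbitAverage_of_ne hz,
      h.component_orbitAverage_of_ne (by rwa [Tuple.orbit_src]), pull_zero]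

theorem orbitAverage_mul {σ : Tuple G n} {b : A} (hb : b ∈ (α.tupleIdeal σ).alg) (u : A) :
    h.orbitAverage σ.orbit u * b = (n : ℂ)⁻¹ • ∑ k ∈ σ.1, α.pull k⁻¹ (u * α.pull k b) := by
  rw [h.component_mul σ _ b hb, h.component_orbitAverage rfl, smul_mul_assoc, Finset.sum_mul]
  congr 1
  refine Finset.sum_congr rfl fun k hk => ?_
  have hp := pull_mem_tuple hb hk
  rw [h.component_mul _ u _ hp, α.pull_mul
    (mem_dom_of_mem_tuple (h.component_mem _ u) (Tuple.inv_mem_src hk))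
    (mem_dom_of_mem_tuple hp (Tuple.inv_mem_src hk)),
    α.pull_inv_pull (mem_dom_of_mem_tuple hb hk)]

open Filter Topology in
include h in
-- Nondegeneracy of `A^G` in `A`: if `u` runs through an approximate unit of `A`, then the orbit
-- averages of `u` are fixed and act on each `A_σ` as an approximate unit.
theorem span_fixedPoints_mul_dense : (Submodule.span ℂ
    {x : A | ∃ (a : α.fixedPoints) (b : A), x = a * b}).topologicalClosure = ⊤ := by
  rw [← top_le_iff, ← h.span_tuple_dense]
  refine Submodule.topologicalClosure_minimal _ (Submodule.span_le.2 ?_)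
    (Submodule.isClosed_topologicalClosure _)
  rintro b ⟨σ, hb⟩
  obtain ⟨l, hl0, -, -, hl⟩ := exists_approximateUnit A
  have hlim : Tendsto (fun u => h.orbitAverage σ.orbit u * b) l (𝓝 b) := by
    simp_rw [h.orbitAverage_mul hb]
    -- This is the formula for the product with the average, with `u` replaced by a unit: `n` copies
    -- of `b` divided by `n`.
    have hb' : b = (n : ℂ)⁻¹ • ∑ k ∈ σ.1, α.pull k⁻¹ (α.pull k b) := by
      rw [Finset.sum_congr rfl fun k hk =>
        α.pull_inv_pull (mem_dom_of_mem_tuple hb (show k ∈ σ from hk)), Finset.sum_const, σ.2.2,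
        ← Nat.cast_smul_eq_nsmul ℂ, smul_smul, inv_mul_cancel₀ σ.natCast_ne_zero, one_smul]
    nth_rw 2 [hb']
    refine (tendsto_finsetSum _ fun k _ => ?_).const_smul _
    have hp := α.pull_mem k b
    rw [tendsto_iff_norm_sub_tendsto_zero]
    refine squeeze_zero (fun _ => norm_nonneg _) (fun u => ?_)
      (tendsto_iff_norm_sub_tendsto_zero.1 (hl (α.pull k b)))
    rw [← α.pull_sub ((α.dom k⁻¹).mul_mem_left u hp) hp]
    exact α.norm_pull_le _ _
  exact mem_closure_of_tendsto hlim (Eventually.of_forall fun u =>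
    Submodule.subset_span ⟨⟨_, h.orbitAverage_isFixed σ.orbit u⟩, b, rfl⟩)

open Filter Topology in
include h in
/-- An approximate unit of the fixed point algebra which is an approximate unit of `A`. -/
theorem exists_approximateUnit_fixedPoints : ∃ l : Filter α.fixedPoints, l.NeBot ∧
    (∀ᶠ e : α.fixedPoints in l, IsSelfAdjoint e) ∧
    (∀ᶠ e : α.fixedPoints in l, ‖(e : A)‖ ≤ 1) ∧
    (∀ a : α.fixedPoints, Tendsto (fun e => e * a) l (𝓝 a)) ∧
    ∀ b : A, Tendsto (fun e : α.fixedPoints => (e : A) * b) l (𝓝 b) := by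
  let _ := α.fixedPointsCStar
  obtain ⟨l, hl0, hsa, hn, hl⟩ := exists_approximateUnit α.fixedPoints
  refine ⟨l, hl0, hsa, hn, hl, fun b => ?_⟩
  -- Convergence on products `ab` with `a` fixed is clear from `e(ab) = (ea)b`; contractivity and
  -- density give the rest.
  refine tendsto_of_dense_span (fun e : α.fixedPoints => LinearMap.mulLeft ℂ (e : A))
    (hn.mono fun e he x => ?_) h.span_fixedPoints_mul_dense (ContinuousLinearMap.id ℂ A) ?_ b
  · refine (norm_mul_le _ _).trans (mul_le_of_le_one_left (norm_nonneg x) he)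
  · rintro _ ⟨a, b, rfl⟩
    have h1 := ((continuous_subtype_val.tendsto _).comp (hl a)).mul_const b
    refine h1.congr fun e => ?_
    exact mul_assoc (e : A) a b

/-! ### The regular representations -/

/-- The left side is the `σ`-component of the coefficient of `(a δ_g)(b δ_k)`; this formula makes
the matrices below multiplicative. -/
theorem component_pull_mul {σ : Tuple G n} {g : G} (hg : g ∈ σ) {a b : A}
    (ha : a ∈ (α.dom g).alg) :
    h.component σ (α.pull g⁻¹ (α.pull g a * b)) =
      h.component σ a * α.pull g⁻¹ (h.component (σ.src g) b) := by
  have hgi := Tuple.inv_mem_src hg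
  have e := h.component_pull hgi ((α.dom g⁻¹).mul_mem_right b (α.pull_mem g a))
  rw [Tuple.src_src_inv hg] at e
  rw [e, h.map_mul_component, h.component_pull hg ha, α.pull_mul (α.pull_mem g _)
    (mem_dom_of_mem_tuple (h.component_mem _ b) hgi), α.pull_inv_pull (h.component_mem_dom σ ha)]

open Classical in
/-- The regular representation of the system on the arrows with range `τ`. -/
noncomputable def regularRep (τ : Tuple G n) : Rep α where
  B := CStarMatrix τ.1 τ.1 A
  inst := letI := CStarAlgebra.spectralOrder A
    haveI := CStarAlgebra.spectralOrderedRing A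
    CStarMatrix.instNonUnitalCStarAlgebra
  φ g :=
    -- The entry `(k, kg)` is the component of `a` at `k⁻¹τ`, transported to `A_τ` along the arrow
    -- `k`.
    { toFun := fun a => CStarMatrix.ofMatrix fun k l =>
        if (l : G) = k * g then α.pull (k : G)⁻¹ (h.component (τ.src k) a) else 0
      map_add' := fun a b => by
        refine CStarMatrix.ext fun k l => ?_
        change (if (l : G) = k * g then
            α.pull (k : G)⁻¹ (h.component (τ.src k) (a + b : (α.dom g).alg)) else 0) =
          (if (l : G) = k * g then α.pull (k : G)⁻¹ (h.component (τ.src k) a) else 0) +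
          (if (l : G) = k * g then α.pull (k : G)⁻¹ (h.component (τ.src k) b) else 0)
        split_ifs
        · have hk := Tuple.inv_mem_src (show (k : G) ∈ τ from k.2)
          rw [← α.pull_add (mem_dom_of_mem_tuple (h.component_mem _ _) hk)
            (mem_dom_of_mem_tuple (h.component_mem _ _) hk), ← h.component_add]
          rfl
        · rw [add_zero]
      map_smul' := fun r a => by
        refine CStarMatrix.ext fun k l => ?_
        change (if (l : G) = k * g then
            α.pull (k : G)⁻¹ (h.component (τ.src k) (r • a : (α.dom g).alg)) else 0) =
          r • (if (l : G) = k * g then α.pull (k : G)⁻¹ (h.component (τ.src k) a) else 0)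
        split_ifs
        · have hk := Tuple.inv_mem_src (show (k : G) ∈ τ from k.2)
          rw [← α.pull_smul _ (mem_dom_of_mem_tuple (h.component_mem _ _) hk),
            ← h.component_smul]
          rfl
        · rw [smul_zero] }
  φ_mul g g' a b := by
    refine CStarMatrix.ext fun k l => ?_
    rw [CStarMatrix.mul_apply]
    change ∑ m : τ.1, (if (m : G) = k * g then α.pull (k : G)⁻¹ (h.component (τ.src k) a) else 0) *
        (if (l : G) = m * g' then α.pull (m : G)⁻¹ (h.component (τ.src m) b) else 0) =
      if (l : G) = k * (g * g') then
        α.pull (k : G)⁻¹ (h.component (τ.src k) (α.deltaMul g g' a b)) else 0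
    have e : (α.deltaMul g g' a b : A) = α.pull g⁻¹ (α.pull g a * b) := by
      change (α.act g _ : A) = _
      rw [act_eq_pull α (inv_inv g).symm, pull_of_mem α a.2]
    have hk : (k : G) ∈ τ := k.2
    have hki := Tuple.inv_mem_src hk
    rw [e]
    -- If `kg ∈ τ`, the only possible intermediate index is `kg`; otherwise the components of both
    -- coefficients at `k⁻¹τ` vanish.
    by_cases hg : g ∈ τ.src k
    · have hkg : (k : G) * g ∈ τ := (Tuple.mem_src hk g).1 hg
      rw [Finset.sum_eq_single (⟨k * g, hkg⟩ : τ.1), if_pos rfl, h.component_pull_mul hg a.2]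
      · simp only [mul_assoc]
        split_ifs
        · have hm := h.component_mem (τ.src (k * g)) (b : A)
          have e1 := Tuple.src_src hk hg
          rw [← e1] at hm ⊢
          rw [α.pull_mul (mem_dom_of_mem_tuple (h.component_mem _ _) hki)
            (mem_dom_of_mem_tuple (pull_inv_mem_tuple hg hm) hki),
            pull_pull_tuple hm (Tuple.inv_mem_src hg) (by rwa [Tuple.src_src_inv hg]),
            mul_inv_rev]
        · rw [mul_zero]
      · intro m _ hne
        rw [if_neg (fun hm => hne (Subtype.ext hm)), zero_mul]
      · simp
    · rw [h.component_eq_zero_of_dom hg a.2, h.component_eq_zero_of_dom hg (α.pull_inv_mem g _),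
        pull_zero, ite_self, Finset.sum_eq_zero]
      intro m _
      rw [ite_self, zero_mul]
  φ_star g a := by
    refine CStarMatrix.ext fun k l => ?_
    rw [CStarMatrix.star_apply]
    change star (if (k : G) = l * g then α.pull (l : G)⁻¹ (h.component (τ.src l) a) else 0) =
      if (l : G) = k * g⁻¹ then
        α.pull (k : G)⁻¹ (h.component (τ.src k) (α.deltaStar g a)) else 0
    have e : (α.deltaStar g a : A) = α.pull g (star (a : A)) := by
      rw [pull_of_mem α (star_mem a.2)]
      rfl
    have hl : (l : G) ∈ τ := l.2
    have hli := Tuple.inv_mem_src hl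
    rw [e]
    simp only [eq_mul_inv_iff_mul_eq, eq_comm (a := (l : G) * g)]
    split_ifs with hkl
    · have hg : g ∈ τ.src l := by rw [Tuple.mem_src hl, ← hkl]; exact k.2
      have hm := h.component_mem (τ.src l) (star (a : A))
      rw [hkl, ← Tuple.src_src hl hg, h.component_pull hg (star_mem a.2),
        pull_pull_tuple hm hg (by
          rw [mul_inv_rev, Tuple.mem_src hg, mul_inv_cancel_left]; exact hli),
        mul_inv_rev, mul_inv_cancel_left, h.map_star_component,
        α.pull_star (mem_dom_of_mem_tuple (h.component_mem _ _) hli)]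
    · exact star_zero A

end HasDecomposition

end PartialAction

/-! ### Injectivity of the corner map and the unit of the corner -/

namespace PartialAction

variable {G : Type v} [Group G] {A : Type u} [NonUnitalCStarAlgebra A] {α : PartialAction G A}
  {n : ℕ}

open Filter Topology in
theorem tendsto_single {ι : Type*} {l : Filter ι} {u : ι → A} {a : A} {g : G}
    (hu : ∀ i, u i ∈ (α.dom g).alg) (ha : a ∈ (α.dom g).alg) (hl : Tendsto u l (𝓝 a)) :
    Tendsto (fun i => α.single g (u i)) l (𝓝 (α.single g a)) := by
  rw [tendsto_iff_norm_sub_tendsto_zero] at hl ⊢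
  refine squeeze_zero (fun _ => norm_nonneg _) (fun i => ?_) hl
  have e := α.single_add (sub_mem (hu i) ha) ha
  rw [sub_add_cancel] at e
  rw [e, add_sub_cancel_right]
  exact α.norm_single_le g _

namespace HasDecomposition

variable (h : α.HasDecomposition n)

include h in
-- The `(1, 1)` matrix entry in the regular representation sends `x δ_1` to `x` and kills `x δ_k`
-- for `k ≠ 1`.
theorem regularRep_single_one (τ : Tuple G n) {x : A} (hx : x ∈ (α.tupleIdeal τ).alg)
    (hsum : ∑ k ∈ τ.1, α.single k x = 0) : x = 0 := by
  classical
  let i : τ.1 := ⟨1, τ.one_mem⟩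
  let entry : (h.regularRep τ).B →+ A :=
    { toFun := fun M => (M : CStarMatrix τ.1 τ.1 A) i i
      map_zero' := rfl
      map_add' := fun _ _ => rfl }
  have h1 := congrArg (fun y => entry (α.lift (h.regularRep τ) y)) hsum
  simp only [map_sum, map_zero] at h1
  rw [Finset.sum_eq_single_of_mem 1 τ.2.1] at h1
  · rw [α.single_of_mem (mem_dom_of_mem_tuple hx τ.one_mem)] at h1
    change (if (1 : G) = 1 * 1 then α.pull (1 : G)⁻¹ (h.component (τ.src 1) x) else 0) = 0 at h1
    rwa [if_pos (mul_one 1).symm, inv_one, pull_one, Tuple.src_one, h.component_self τ hx] at h1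
  · intro k hk hne
    rw [α.single_of_mem (mem_dom_of_mem_tuple hx hk)]
    change (if (1 : G) = 1 * k then α.pull (1 : G)⁻¹ (h.component (τ.src 1) x) else 0) = 0
    rw [if_neg]
    rw [one_mul]
    exact hne.symm

/-- Multiplying `c(a) = 0` on the left by `π_σ(a)⋆ δ_1` isolates `∑_{k ∈ σ} π_σ(a)⋆ a δ_k`, so
`π_σ(a)⋆ π_σ(a) = 0` for every `σ`. -/
theorem corner_injective : Function.Injective h.corner := by
  rw [injective_iff_map_eq_zero]
  intro a ha
  refine Subtype.ext (h.ext_component fun σ => ?_)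
  have hm := star_mem (h.component_mem σ (a : A))
  have h1 := h.single_mul_corner σ.one_mem hm a
  rw [ha, mul_zero, eq_comm, smul_eq_zero, or_iff_right (inv_ne_zero σ.natCast_ne_zero)] at h1
  have h2 := h.regularRep_single_one σ ((α.tupleIdeal σ).mul_mem_right _ hm) h1
  rw [h.mul_component σ _ _ hm] at h2
  change _ = h.component σ 0
  rw [(CStarRing.star_mul_self_eq_zero_iff _).1 h2, h.component_zero]

theorem corner_of_mem {z : TupleOrbit G n} (a : α.fixedPoints)
    (ha : (a : A) ∈ (h.orbitIdeal z).alg) : h.corner a = h.orbitCorner z a := by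
  classical
  refine (h.hasSum_corner a).unique (hasSum_single z fun w hw => ?_)
  rw [← h.orbitPart_of_mem ha, h.orbitCorner_orbitPart, if_neg hw]

theorem orbitAverage_mem (z : TupleOrbit G n) (u : A) :
    h.orbitAverage z u ∈ (h.orbitIdeal z).alg :=
  SMulMemClass.smul_mem _ (sum_mem fun _ hσ => mem_orbitSum (TupleOrbit.mem_members.1 hσ)
    (sum_mem fun _ hk => h.pull_inv_component_mem hk u))

/-- The right side is the limit of `p (b δ_k) c(e)` for any `k ∈ ρ`; so the compression of `b δ_k`
by `p` is the image of a fixed point. -/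
theorem orbitCorner_orbitAverage {ρ : Tuple G n} {b : A} (hb : b ∈ (α.tupleIdeal ρ).alg) :
    h.orbitCorner ρ.orbit (h.orbitAverage ρ.orbit b) =
      (n : ℂ)⁻¹ • ∑ g ∈ ρ.1, (n : ℂ)⁻¹ • ∑ k ∈ (ρ.src g).1, α.single k (α.pull g b) := by
  unfold orbitAverage
  simp_rw [map_smul, map_sum]
  congr 1
  rw [← TupleOrbit.sum_swap, Finset.sum_eq_single_of_mem ρ (TupleOrbit.mem_members.2 rfl)]
  · refine Finset.sum_congr rfl fun g hg => ?_
    rw [inv_inv, Tuple.src_src_inv hg, h.component_self ρ hb, ← ρ.orbit_src g,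
      h.orbitCorner_of_mem_tuple (pull_mem_tuple hb hg)]
  · intro σ _ hne
    refine Finset.sum_eq_zero fun g hg => ?_
    rw [inv_inv, Tuple.src_src_inv hg, h.component_of_ne hne.symm hb, pull_zero, map_zero]

open Filter Topology in
-- An approximate unit of `A^G` that also works for `A` gives the strict limit on homogeneous
-- elements, whose span is dense.
theorem exists_cornerUnit : ∃ p : 𝓜(ℂ, α.CrossedProduct),
    IsCornerBy p (Set.range h.corner) ∧ ∀ (ρ : Tuple G n), ∀ k ∈ ρ, ∀ b ∈ (α.tupleIdeal ρ).alg,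
      p.fst (α.single k b) = (n : ℂ)⁻¹ • ∑ g ∈ ρ.1, α.single (g⁻¹ * k) (α.pull g b) := by
  obtain ⟨l, hl0, hsa, hn, hl, hlA⟩ := h.exists_approximateUnit_fixedPoints
  have hlA' : ∀ b : A, Tendsto (fun e : α.fixedPoints => b * e) l (𝓝 b) := fun b => by
    have := (continuous_star.tendsto _).comp (hlA (star b))
    rw [star_star] at this
    refine this.congr' ?_
    filter_upwards [hsa] with e he
    have he' : star (e : A) = e := congrArg Subtype.val he.star_eq
    rw [Function.comp_apply, star_mul, star_star, he']
  have hleft : ∀ (ρ : Tuple G n), ∀ k ∈ ρ, ∀ b ∈ (α.tupleIdeal ρ).alg,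
      Tendsto (fun e => h.corner e * α.single k b) l
        (𝓝 ((n : ℂ)⁻¹ • ∑ g ∈ ρ.1, α.single (g⁻¹ * k) (α.pull g b))) := fun ρ k hk b hb => by
    simp_rw [h.corner_mul_single hk hb]
    refine (tendsto_finsetSum _ fun g hg => ?_).const_smul _
    have hkg : g⁻¹ * k ∈ ρ.src g := by rwa [Tuple.mem_src hg, mul_inv_cancel_left]
    have hm := pull_mem_tuple hb hg
    have e : ∀ a : α.fixedPoints, α.pull g (a * b) = a * α.pull g b := fun a =>
      IsFixed.pull_mul_left a.2 (mem_dom_of_mem_tuple hb hg)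
    simp_rw [e]
    exact tendsto_single (fun a => (α.dom _).mul_mem_left _ (mem_dom_of_mem_tuple hm hkg))
      (mem_dom_of_mem_tuple hm hkg) (hlA _)
  let _ := α.fixedPointsCStar
  obtain ⟨p, hp, hpl⟩ := exists_isCornerBy h.corner h.corner_injective hsa hn hl
    h.span_homogeneous_dense (by
      rintro _ ⟨ρ, k, b, hk, hb, rfl⟩
      -- The fixed point whose image is the compression of `b δ_k` is the orbit average of `b`.
      refine ⟨_, hleft ρ k hk b hb, ⟨_, h.orbitAverage_isFixed ρ.orbit b⟩, ?_⟩
      rw [h.corner_of_mem _ (h.orbitAverage_mem ρ.orbit b), h.orbitCorner_orbitAverage hb]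
      simp_rw [smul_mul_assoc, Finset.sum_mul]
      refine (tendsto_finsetSum _ fun g hg => ?_).const_smul _
      have hkg : g⁻¹ * k ∈ ρ.src g := by rwa [Tuple.mem_src hg, mul_inv_cancel_left]
      have hm := pull_mem_tuple hb hg
      simp_rw [h.single_mul_corner hkg hm]
      refine (tendsto_finsetSum _ fun m hm' => ?_).const_smul _
      exact tendsto_single (fun a => (α.dom _).mul_mem_right _ (mem_dom_of_mem_tuple hm hm'))
        (mem_dom_of_mem_tuple hm hm') (hlA' _))
  exact ⟨p, hp, fun ρ k hk b hb => tendsto_nhds_unique (hpl _) (hleft ρ k hk b hb)⟩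

/-- The unit of the corner. -/
noncomputable def cornerUnit : 𝓜(ℂ, α.CrossedProduct) := h.exists_cornerUnit.choose

theorem isCornerBy_cornerUnit : IsCornerBy h.cornerUnit (Set.range h.corner) :=
  h.exists_cornerUnit.choose_spec.1

theorem cornerUnit_fst_single {ρ : Tuple G n} {k : G} (hk : k ∈ ρ) {b : A}
    (hb : b ∈ (α.tupleIdeal ρ).alg) : h.cornerUnit.fst (α.single k b) =
      (n : ℂ)⁻¹ • ∑ g ∈ ρ.1, α.single (g⁻¹ * k) (α.pull g b) :=
  h.exists_cornerUnit.choose_spec.2 ρ k hk b hb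

end HasDecomposition

end PartialAction

/-! ### Sums over a transversal -/

namespace Transversal

variable {G : Type v} [Group G] {n : ℕ} {τ : Tuple G n} (x : Transversal τ)

theorem x_mem_tuple (j : Fin (x.m + 1)) : x.x j ∈ τ := by
  have := x.x_mem τ.stab.one_mem j
  rwa [one_mul] at this

theorem shift_eq_src (j : Fin (x.m + 1)) : x.shift j = τ.src (x.x j) :=
  (Tuple.src_eq (x.x_mem_tuple j)).symm

theorem src_stab_mul {s : G} (hs : s ∈ τ.stab) (k : Fin (x.m + 1)) :
    τ.src (s * x.x k) = x.shift k :=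
  Tuple.ext fun g => by
    rw [shift_eq_src, Tuple.mem_src (x.x_mem hs k), Tuple.mem_src (x.x_mem_tuple k), mul_assoc]
    exact hs _

theorem src_shift (j k : Fin (x.m + 1)) (s : τ.stab) :
    (x.shift j).src ((x.x j)⁻¹ * s * x.x k) = x.shift k := by
  have hm := x.mem_shift j k s
  rw [shift_eq_src] at hm ⊢
  rw [Tuple.src_src (x.x_mem_tuple j) hm, mul_assoc, mul_inv_cancel_left, x.src_stab_mul s.2]

/-- Equality of `x_i⁻¹τ` and `x_j⁻¹τ` means that `x_i x_j⁻¹` stabilises `τ`, so `x_i` and `x_j` lie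
in the same coset. -/
theorem shift_injective : Function.Injective x.shift := fun i j hij => by
  have hs : x.x i * (x.x j)⁻¹ ∈ τ.stab := fun k => by
    have h1 : (x.x j)⁻¹ * k ∈ x.shift i ↔ (x.x j)⁻¹ * k ∈ x.shift j := by rw [hij]
    rw [shift_eq_src, shift_eq_src, Tuple.mem_src (x.x_mem_tuple i),
      Tuple.mem_src (x.x_mem_tuple j), mul_inv_cancel_left] at h1
    rw [mul_assoc, h1]
  refine x.disjoint i j 1 τ.stab.one_mem _ hs ?_
  rw [one_mul, inv_mul_cancel_right]

/-- Every tuple of the orbit is `(s x_j)⁻¹τ = x_j⁻¹τ` for some `s ∈ H`, and only one `j` occurs. -/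
theorem sum_members {M : Type*} [AddCommMonoid M] {z : TupleOrbit G n} (hτ : τ.orbit = z)
    (f : Tuple G n → M) : ∑ σ ∈ z.members, f σ = ∑ j, f (x.shift j) := by
  symm
  refine Finset.sum_nbij x.shift (fun j _ => ?_) x.shift_injective.injOn (fun σ hσ => ?_)
    fun _ _ => rfl
  · rw [TupleOrbit.mem_members, shift_eq_src, Tuple.orbit_src, hτ]
  · have h1 : τ.orbit = σ.orbit := hτ.trans (TupleOrbit.mem_members.1 hσ).symm
    obtain ⟨g, hg, rfl⟩ := (τ.orbit_eq_iff_src σ).1 h1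
    obtain ⟨j, s, hs, rfl⟩ := (x.mem_iff g).1 hg
    exact ⟨j, Finset.mem_coe.2 (Finset.mem_univ j), (x.src_stab_mul hs j).symm⟩

theorem sum_tuple {M : Type*} [AddCommMonoid M] (f : G → M) :
    ∑ g ∈ τ.1, f g = ∑ k, ∑ s : τ.stab, f (s * x.x k) := by
  rw [← Fintype.sum_prod_type' (f := fun (k : Fin (x.m + 1)) (s : τ.stab) => f (s * x.x k))]
  symm
  refine Finset.sum_nbij (fun p => (p.2 : G) * x.x p.1) (fun p _ => x.x_mem p.2.2 p.1) ?_ ?_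
    fun _ _ => rfl
  · rintro ⟨i, s⟩ _ ⟨j, t⟩ _ hst
    have hij := x.disjoint i j s s.2 t t.2 hst
    subst hij
    exact Prod.ext rfl (Subtype.ext (mul_right_cancel hst))
  · intro g hg
    obtain ⟨j, s, hs, rfl⟩ := (x.mem_iff g).1 hg
    exact ⟨(j, ⟨s, hs⟩), Finset.mem_coe.2 (Finset.mem_univ _), rfl⟩

theorem sum_shift {M : Type*} [AddCommMonoid M] (j : Fin (x.m + 1)) (f : G → M) :
    ∑ g ∈ (x.shift j).1, f g = ∑ k, ∑ s : τ.stab, f ((x.x j)⁻¹ * s * x.x k) := by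
  rw [shift_eq_src, Tuple.sum_src (x.x_mem_tuple j), x.sum_tuple]
  simp only [mul_assoc]

/-- Counting `τ` by cosets identifies the normalisation in the theorem with the number of arrows
into a tuple. -/
theorem card_eq : (Fintype.card τ.stab : ℂ) * (x.m + 1) = n := by
  have h1 := x.sum_tuple fun _ => (1 : ℂ)
  rw [Finset.sum_const, τ.2.2] at h1
  simp only [Finset.sum_const, Finset.card_univ, Fintype.card_fin, nsmul_eq_mul, mul_one,
    Nat.cast_add, Nat.cast_one] at h1
  rw [h1, mul_comm]

end Transversal

namespace PartialAction

variable {G : Type v} [Group G] {A : Type u} [NonUnitalCStarAlgebra A] {α : PartialAction G A}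
  {n : ℕ}

namespace HasDecomposition

variable (h : α.HasDecomposition n) {z : TupleOrbit G n}

/-! ### The decomposition of the system of an orbit -/

theorem mem_tupleIdeal_orbitSystem (σ : Tuple G n) (b : (h.orbitIdeal z).alg) :
    b ∈ ((h.orbitSystem z).tupleIdeal σ).alg ↔ (b : A) ∈ (α.tupleIdeal σ).alg := by
  rw [mem_tupleIdeal, mem_tupleIdeal]
  rfl

variable (z) in
-- This allows the whole construction to be repeated inside one orbit ideal, where density holds
-- without closure because the sum is finite.
theorem orbitSystem_hasDecomposition : (h.orbitSystem z).HasDecomposition n where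
  dense := by
    refine eq_top_iff.2 fun b _ => Submodule.le_topologicalClosure _ ?_
    have e : b = ∑ σ : {σ : Tuple G n // σ.orbit = z},
        ⟨h.component σ.1 b, mem_orbitSum σ.2 (h.component_mem σ.1 b)⟩ := Subtype.ext (by
      rw [AddSubmonoidClass.coe_finsetSum]
      exact h.eq_sum_component b.2)
    rw [e]
    exact sum_mem fun σ _ => Submodule.mem_iSup_of_mem
      (p := fun σ : Tuple G n => ((h.orbitSystem z).tupleIdeal σ).toSubmodule) σ.1
      ((h.mem_tupleIdeal_orbitSystem σ.1 _).2 (h.component_mem σ.1 b))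
  inter τ g hg := by
    refine eq_bot_iff.2 fun b hb => ?_
    exact Subtype.ext (h.eq_zero hg ((h.mem_tupleIdeal_orbitSystem τ b).1 hb.1) hb.2)

theorem coe_component_orbitSystem (σ : Tuple G n) (b : (h.orbitIdeal z).alg) :
    ((h.orbitSystem_hasDecomposition z).component σ b : A) = h.component σ b := by
  have hm := (h.mem_tupleIdeal_orbitSystem σ _).1
    ((h.orbitSystem_hasDecomposition z).component_mem σ b)
  by_cases hσ : σ.orbit = z
  · have hm' : h.component σ b ∈ (h.orbitIdeal z).alg := mem_orbitSum hσ (h.component_mem σ b)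
    refine congrArg Subtype.val (HasDecomposition.component_eq _ σ (b := ⟨_, hm'⟩)
      ((h.mem_tupleIdeal_orbitSystem σ _).2 (h.component_mem σ b)) fun c hc => ?_)
    exact Subtype.ext (h.component_mul σ b c ((h.mem_tupleIdeal_orbitSystem σ c).1 hc))
  · rw [h.component_of_mem_orbitIdeal b.2 hσ, ← h.component_self σ hm,
      h.component_of_mem_orbitIdeal (Subtype.property _) hσ]

theorem coe_pull_orbitSystem (g : G) (b : (h.orbitIdeal z).alg) :
    ((h.orbitSystem z).pull g b : A) = α.pull g b := by
  by_cases hb : (b : A) ∈ (α.dom g).alg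
  · have hb' : b ∈ ((h.orbitSystem z).dom g).alg := hb
    rw [pull_of_mem _ hb, pull_of_mem _ hb']
    rfl
  · have hb' : b ∉ ((h.orbitSystem z).dom g).alg := hb
    rw [pull, pull, dif_neg hb, dif_neg hb']
    rfl

theorem orbitIncl_single (g : G) (b : (h.orbitIdeal z).alg) :
    h.orbitIncl z ((h.orbitSystem z).single g b) = α.single g b := by
  by_cases hb : (b : A) ∈ (α.dom g).alg
  · have hb' : b ∈ ((h.orbitSystem z).dom g).alg := hb
    rw [single_of_mem _ hb, single_of_mem _ hb']
    rfl
  · have hb' : b ∉ ((h.orbitSystem z).dom g).alg := hb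
    rw [single, single, dif_neg hb, dif_neg hb', map_zero]

theorem isFixed_orbitSystem {b : (h.orbitIdeal z).alg} (hb : α.IsFixed (b : A)) :
    (h.orbitSystem z).IsFixed b := by
  refine isFixed_of_pull fun g c hc => Subtype.ext ?_
  rw [coe_pull_orbitSystem]
  change α.pull g ((b : A) * c) = b * ((h.orbitSystem z).pull g c : A)
  have hc' : (c : A) ∈ (α.dom g).alg := hc
  rw [coe_pull_orbitSystem, hb.pull_mul_left hc']

/-- In the system of the orbit `z`, components at other orbits vanish, so its corner map consists of
the single term at `z`. -/
theorem mem_orbitIdeal_orbitSystem (b : (h.orbitIdeal z).alg) :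
    b ∈ ((h.orbitSystem_hasDecomposition z).orbitIdeal z).alg := by
  classical
  have e : (h.orbitSystem_hasDecomposition z).orbitPart z b = b := by
    refine HasDecomposition.ext_component (h.orbitSystem_hasDecomposition z) fun σ => ?_
    rw [component_orbitPart]
    split_ifs with hσ
    · rfl
    · refine Subtype.ext ?_
      rw [coe_component_orbitSystem, h.component_of_mem_orbitIdeal b.2 hσ]
      rfl
  rw [← e]
  exact orbitPart_mem _ z b

theorem orbitSystem_corner_eq (a : (h.orbitSystem z).fixedPoints) :
    (h.orbitSystem_hasDecomposition z).corner a =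
      (h.orbitSystem_hasDecomposition z).orbitCorner z a :=
  corner_of_mem _ a (h.mem_orbitIdeal_orbitSystem _)

theorem component_shift_eq_proj {τ : Tuple G n} (hτ : τ.orbit = z) (x : Transversal τ)
    (j : Fin (x.m + 1)) (a : (h.orbitIdeal z).alg) :
    (h.orbitSystem_hasDecomposition z).component (x.shift j) a = h.proj hτ x j a :=
  Subtype.ext (h.coe_component_orbitSystem _ a)

/-- The indices `(j, k, s)` enumerate the arrows of the orbit: `x_j⁻¹τ` is the range and `x_j⁻¹ s
x_k` the group element. -/
theorem orbitSystem_corner_eq_cornerFun {τ : Tuple G n} (hτ : τ.orbit = z) (x : Transversal τ)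
    (a : (h.orbitSystem z).fixedPoints) :
    (h.orbitSystem_hasDecomposition z).corner a = h.cornerFun hτ x a := by
  rw [orbitSystem_corner_eq, orbitCorner_apply, x.sum_members hτ, cornerFun, x.card_eq]
  congr 1
  refine Finset.sum_congr rfl fun j _ => ?_
  rw [x.sum_shift]
  refine Finset.sum_congr rfl fun k _ => Finset.sum_congr rfl fun s _ => ?_
  rw [h.component_shift_eq_proj hτ x, delta_eq_single _ rfl]

theorem cornerUnit_fst_delta {τ : Tuple G n} (hτ : τ.orbit = z) (x : Transversal τ) (g : G)
    (a : ((h.orbitSystem z).dom g).alg) :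
    (h.orbitSystem_hasDecomposition z).cornerUnit.fst ((h.orbitSystem z).delta g a) =
      h.cornerUnitFun hτ x g a := by
  set h' := h.orbitSystem_hasDecomposition z
  have e : (h.orbitSystem z).delta g a =
      ∑ ρ ∈ z.members, (h.orbitSystem z).single g (h'.component ρ a) := by
    rw [delta_eq_single _ rfl, ← single_sum _ _ _ fun ρ _ => h'.component_mem_dom ρ a.2]
    exact congrArg _ (orbitPart_of_mem h' (h.mem_orbitIdeal_orbitSystem _)).symm
  have key : ∀ ρ : Tuple G n, h'.cornerUnit.fst ((h.orbitSystem z).single g (h'.component ρ a)) =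
      (n : ℂ)⁻¹ • ∑ k ∈ ρ.1, (h.orbitSystem z).single (k⁻¹ * g)
        ((h.orbitSystem z).pull k (h'.component ρ a)) := fun ρ => by
    by_cases hg : g ∈ ρ
    · exact h'.cornerUnit_fst_single hg (h'.component_mem ρ a)
    · rw [h'.component_eq_zero_of_dom hg a.2, single_zero, map_zero]
      simp only [pull_zero, single_zero, Finset.sum_const_zero, smul_zero]
  -- Inverting the arrows turns `k⁻¹g` into `x_j⁻¹ s x_k g` and places the component at the source
  -- `x_k⁻¹τ`.
  rw [e, map_sum, Finset.sum_congr rfl fun ρ _ => key ρ, ← Finset.smul_sum,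
    ← TupleOrbit.sum_swap z fun ρ k => (h.orbitSystem z).single (k⁻¹ * g)
        ((h.orbitSystem z).pull k (h'.component ρ a)), x.sum_members hτ, cornerUnitFun, x.card_eq]
  congr 1
  refine Finset.sum_congr rfl fun j _ => ?_
  rw [x.sum_shift]
  refine Finset.sum_congr rfl fun k _ => Finset.sum_congr rfl fun s _ => ?_
  rw [x.src_shift, h.component_shift_eq_proj hτ x, inv_inv, delta_eq_single _ rfl]
  have e1 : (h.actProj hτ x j k s a : (h.orbitIdeal z).alg) =
      (h.orbitSystem z).pull ((x.x j)⁻¹ * s * x.x k)⁻¹ (h.proj hτ x k a) := by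
    unfold actProj
    exact act_eq_pull _ (inv_inv _).symm _
  exact congrArg _ e1.symm

/-! ### The direct sum over the orbits -/

/-- Each `π_σ` is continuous and kills all terms except that of the orbit of `σ`; this gives
uniqueness of the decomposition. -/
theorem eq_orbitPart_of_hasSum {a : A} {f : ∀ z : TupleOrbit G n, (h.orbitIdeal z).alg}
    (hf : HasSum (fun z => (f z : A)) a) (w : TupleOrbit G n) : (f w : A) = h.orbitPart w a := by
  classical
  refine h.ext_component fun σ => ?_
  rw [h.component_orbitPart]
  split_ifs with hσ
  · have h1 : HasSum (fun z => h.component σ (f z)) (h.component σ a) :=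
      (h.componentL σ).hasSum hf
    refine (h1.unique (hasSum_single w fun z hz => ?_)).symm
    exact h.component_of_mem_orbitIdeal (f z).2 (fun e => hz (e.symm.trans hσ))
  · exact h.component_of_mem_orbitIdeal (f w).2 hσ

theorem orbitIncl_orbitCorner (b : (h.orbitIdeal z).alg) :
    h.orbitIncl z ((h.orbitSystem_hasDecomposition z).orbitCorner z b) = h.orbitCorner z b := by
  rw [orbitCorner_apply, orbitCorner_apply, map_smul, map_sum]
  congr 1
  refine Finset.sum_congr rfl fun σ _ => ?_
  rw [map_sum]
  refine Finset.sum_congr rfl fun g _ => ?_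
  rw [orbitIncl_single, coe_component_orbitSystem]

/-- Both sides are bounded linear in `b` and are given by the same formula on homogeneous elements.
-/
theorem cornerUnit_fst_orbitIncl (b : (h.orbitSystem z).CrossedProduct) :
    h.cornerUnit.fst (h.orbitIncl z b) =
      h.orbitIncl z ((h.orbitSystem_hasDecomposition z).cornerUnit.fst b) := by
  let L : (h.orbitSystem z).CrossedProduct →L[ℂ] α.CrossedProduct :=
    LinearMap.mkContinuous (LinearMapClass.linearMap (h.orbitIncl z)) 1 fun x => by
      rw [one_mul]; exact NonUnitalStarAlgHom.norm_apply_le (h.orbitIncl z) x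
  refine congrArg (fun T : (h.orbitSystem z).CrossedProduct →L[ℂ] α.CrossedProduct => T b)
    (ContinuousLinearMap.ext_on (f := h.cornerUnit.fst.comp L)
      (g := L.comp (h.orbitSystem_hasDecomposition z).cornerUnit.fst)
      (s := homogeneous (h.orbitSystem z) n) ?_ ?_)
  · rw [dense_iff_closure_eq, ← Submodule.topologicalClosure_coe,
      (h.orbitSystem_hasDecomposition z).span_homogeneous_dense]
    rfl
  · rintro _ ⟨σ, g, a, hg, ha, rfl⟩
    change h.cornerUnit.fst (h.orbitIncl z _) = h.orbitIncl z _
    rw [orbitIncl_single, h.cornerUnit_fst_single hg ((h.mem_tupleIdeal_orbitSystem σ a).1 ha)]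
    refine Eq.trans ?_ (congrArg (h.orbitIncl z) (cornerUnit_fst_single _ hg ha)).symm
    rw [map_smul, map_sum]
    congr 1
    refine Finset.sum_congr rfl fun k _ => ?_
    rw [orbitIncl_single, coe_pull_orbitSystem]

end HasDecomposition

end PartialAction

/-! ### Assembly of the theorem -/

theorem mainTheorem4 {G : Type v} [Group G] {A : Type u} [NonUnitalCStarAlgebra A] (n : ℕ)
    (α : PartialAction G A) (h : α.HasDecomposition n) :
    -- the maps `c_τ` and the multipliers `c_τ(1)`, a priori depending on `x_1, …, x_m`
    ∃ (c : ∀ (z : TupleOrbit G n) (τ : Tuple G n) (_ : τ.orbit = z) (_ : Transversal τ),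
        (h.orbitSystem z).fixedPoints →⋆ₙₐ[ℂ] (h.orbitSystem z).CrossedProduct)
      (p : ∀ (z : TupleOrbit G n) (τ : Tuple G n) (_ : τ.orbit = z) (_ : Transversal τ),
        𝓜(ℂ, (h.orbitSystem z).CrossedProduct)),
      -- (1) the formulas for `c_τ` and `c_τ(1)`, and `c_τ` is a corner embedding
      (∀ (z : TupleOrbit G n) (τ : Tuple G n) (hτ : τ.orbit = z) (x : Transversal τ),
        (∀ a : (h.orbitSystem z).fixedPoints, c z τ hτ x a = h.cornerFun hτ x a) ∧
        (∀ (g : G) (a : ((h.orbitSystem z).dom g).alg),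
          (p z τ hτ x).fst ((h.orbitSystem z).delta g a) = h.cornerUnitFun hτ x g a) ∧
        Function.Injective (c z τ hτ x) ∧
        IsCornerBy (p z τ hτ x) (Set.range (c z τ hτ x))) ∧
      -- (2) independence of `x_1, …, x_m`
      (∀ (z : TupleOrbit G n) (τ : Tuple G n) (hτ : τ.orbit = z) (x y : Transversal τ),
        c z τ hτ x = c z τ hτ y) ∧
      -- (3) `c_{gτ} = c_τ` for `g ∈ τ⁻¹`
      (∀ (z : TupleOrbit G n) (τ : Tuple G n) (hτ : τ.orbit = z) (g : G) (hg : g⁻¹ ∈ τ)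
        (x : Transversal τ) (y : Transversal (τ.translate g hg)),
        c z (τ.translate g hg) ((τ.orbit_translate g hg).trans hτ) y = c z τ hτ x) ∧
      -- `A^G` is the direct sum of the algebras `A_{G·τ}^G`
      (∀ a : α.fixedPoints, ∃! f : ∀ z : TupleOrbit G n, (h.orbitSystem z).fixedPoints,
        HasSum (fun z => ((f z : (h.orbitIdeal z).alg) : A)) (a : A)) ∧
      -- the corner embedding `c = ⨁ c_{τ_z}`, the same for every section `z ↦ τ_z`
      ∃ (cG : α.fixedPoints →⋆ₙₐ[ℂ] α.CrossedProduct) (pG : 𝓜(ℂ, α.CrossedProduct)),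
        (∀ (s : TupleOrbit G n → Tuple G n) (hs : ∀ z, (s z).orbit = z)
          (x : ∀ z, Transversal (s z)) (a : α.fixedPoints)
          (f : ∀ z : TupleOrbit G n, (h.orbitSystem z).fixedPoints),
          HasSum (fun z => ((f z : (h.orbitIdeal z).alg) : A)) (a : A) →
          HasSum (fun z => h.orbitIncl z (c z (s z) (hs z) (x z) (f z))) (cG a)) ∧
        (∀ (z : TupleOrbit G n) (τ : Tuple G n) (hτ : τ.orbit = z) (x : Transversal τ)
          (b : (h.orbitSystem z).CrossedProduct),
          pG.fst (h.orbitIncl z b) = h.orbitIncl z ((p z τ hτ x).fst b)) ∧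
        Function.Injective cG ∧
        IsCornerBy pG (Set.range cG) := by
  -- The witnesses depend on the orbit alone, which makes independence of the transversal and of the
  -- representative hold by `rfl`.
  refine ⟨fun z _ _ _ => (h.orbitSystem_hasDecomposition z).corner,
    fun z _ _ _ => (h.orbitSystem_hasDecomposition z).cornerUnit,
    fun z τ hτ x => ⟨h.orbitSystem_corner_eq_cornerFun hτ x, h.cornerUnit_fst_delta hτ x,
      PartialAction.HasDecomposition.corner_injective _,
      PartialAction.HasDecomposition.isCornerBy_cornerUnit _⟩,
    fun _ _ _ _ _ => rfl, fun _ _ _ _ _ _ _ => rfl, fun a => ?_,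
    h.corner, h.cornerUnit, fun s hs x a f hf => ?_,
    fun z τ hτ x b => h.cornerUnit_fst_orbitIncl b, h.corner_injective, h.isCornerBy_cornerUnit⟩
  · refine ⟨fun z => ⟨⟨h.orbitPart z a, h.orbitPart_mem z a⟩,
      h.isFixed_orbitSystem (h.orbitPart_isFixed a.2 z)⟩, h.hasSum_orbitPart a, fun f hf => ?_⟩
    funext z
    exact Subtype.ext (Subtype.ext (h.eq_orbitPart_of_hasSum hf z))
  · classical
    -- Any decomposition of `a` must have the orbit parts as its terms, so each summand is the orbit
    -- corner map at `a` itself.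
    have e : (fun z => h.orbitIncl z ((h.orbitSystem_hasDecomposition z).corner (f z))) =
        fun z => h.orbitCorner z a := funext fun z => by
      rw [h.orbitSystem_corner_eq, h.orbitIncl_orbitCorner,
        h.eq_orbitPart_of_hasSum (f := fun z => f z) hf z, h.orbitCorner_orbitPart, if_pos rfl]
    exact e ▸ h.hasSum_corner a
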